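/- Let $S^1=\mathbb R/\mathbb Z$ and let $s>5/2$ be real. Let $H^r(S^1)$ denote the $L^2$-based Sobolev space of real functions on $S^1$, and $H^s_0(S^1)=\{u\in H^s(S^1): u(0)=0\}$. Let $\mathrm{Diff}^s_0(S^1)$ be the orientation-preserving diffeomorphisms $\varphi$ of $S^1$ of class $H^s$ with $\varphi(0)=0$, and let $G^s=\mathrm{Diff}^s_0(S^1)\circledS H^{s-1}(S^1)$ be the semidirect product with multiplication $(\varphi,\alpha)(\psi,\beta)=(\varphi\circ\psi,\ \beta+\alpha\circ\psi)$. The global chart $(\varphi,\alpha)\mapsto(\varphi-\mathrm{id},\alpha)$ identifies $G^s$ with the subset $\{(h,\alpha): 1+h_x>0\}$ of $H^s_0(S^1)\times H^{s-1}(S^1)$. Equip $G^s$ with the right-invariant metric (with $\kappa=-1$) $$\langle U,V\rangle_{(\varphi,\alpha)}=\langle (U_1\circ\varphi^{-1},U_2\circ\varphi^{-1}),(V_1\circ\varphi^{-1},V_2\circ\varphi^{-1})\rangle_{(\mathrm{id},0)},\qquad \langle u,v\rangle_{(\mathrm{id},0)}=\frac14\int_{S^1}\left(u_{1x}v_{1x}-u_2v_2\right)dx,$$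 where $U,V\in T_{(\varphi,\alpha)}G^s\simeq H^s_0(S^1)\times H^{s-1}(S^1)$. Then $G^s$ is open in $H^s_0(S^1)\times H^{s-1}(S^1)$, $\langle\cdot,\cdot\rangle$ is a smooth (weakly) nondegenerate pseudo-Riemannian metric on $G^s$ which admits a smooth Levi-Civita connection $\nabla$ (torsion-free and compatible with the metric), and the sectional curvature of $(G^s,\langle\cdot,\cdot\rangle)$ is constant and equal to $1$: with $R(X,Y)Z=\nabla_X\nabla_YZ-\nabla_Y\nabla_XZ-\nabla_{[X,Y]}Z$, for every $p\in G^s$ and all $u,v\in T_pG^s$ that span a nondegenerate plane, i.e. $\langle u,u\rangle_p\langle v,v\rangle_p-\langle u,v\rangle_p^2\neq0$, $$\frac{\langle R(u,v)v,u\rangle_p}{\langle u,u\rangle_p\langle v,v\rangle_p-\langle u,v\rangle_p^2}=1 .$$ -/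

import Mathlib

open scoped ContDiff

namespace HunterSaxton

noncomputable section

/-! ### Sobolev spaces on the circle `ℝ / ℤ` -/

/-- The weighted Fourier coefficients `(1 + n²)^{r/2} f̂(n)` of a real continuous function on
the circle `ℝ / ℤ`. -/
def weightedCoeff (r : ℝ) (f : C(UnitAddCircle, ℝ)) (n : ℤ) : ℂ :=
  (((1 + (n : ℝ) ^ 2) ^ (r / 2) : ℝ) : ℂ) * fourierCoeff (fun x => ((f x : ℝ) : ℂ)) n

theorem integrable_ofReal (f : C(UnitAddCircle, ℝ)) :
    MeasureTheory.Integrable (fun x => ((f x : ℝ) : ℂ))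
      (AddCircle.haarAddCircle (T := (1 : ℝ))) :=
  (Complex.continuous_ofReal.comp f.continuous).integrable_of_hasCompactSupport
    (HasCompactSupport.of_compactSpace _)

theorem weightedCoeff_add (r : ℝ) (f g : C(UnitAddCircle, ℝ)) :
    weightedCoeff r (f + g) = weightedCoeff r f + weightedCoeff r g := by
  funext n
  have h : (fun x => (((f + g) x : ℝ) : ℂ))
      = (fun x => ((f x : ℝ) : ℂ)) + (fun x => ((g x : ℝ) : ℂ)) := by
    funext x; simp
  simp only [weightedCoeff, Pi.add_apply]
  rw [h, fourierCoeff.add (integrable_ofReal f) (integrable_ofReal g), Pi.add_apply, mul_add]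

theorem weightedCoeff_smul (r c : ℝ) (f : C(UnitAddCircle, ℝ)) :
    weightedCoeff r (c • f) = c • weightedCoeff r f := by
  funext n
  have h : (fun x => (((c • f) x : ℝ) : ℂ)) = (c : ℂ) • (fun x => ((f x : ℝ) : ℂ)) := by
    funext x; simp
  simp only [weightedCoeff, Pi.smul_apply]
  rw [h]
  have := fourierCoeff.const_smul (T := (1 : ℝ)) (fun x => ((f x : ℝ) : ℂ)) (c : ℂ) n
  rw [this, smul_eq_mul, Complex.real_smul]
  ring

/-- The continuous functions `f : ℝ / ℤ → ℝ` with `∑ₙ (1 + n²)^r |f̂(n)|² < ∞`.  For `r > 1/2`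
every class in `H^r` has exactly one continuous representative, so this is all of `H^r`. -/
def sobolevSubmodule (r : ℝ) : Submodule ℝ C(UnitAddCircle, ℝ) where
  carrier := {f | Memℓp (weightedCoeff r f) 2}
  add_mem' {f g} hf hg := by
    simp only [Set.mem_ofPred_eq] at hf hg ⊢
    rw [weightedCoeff_add]
    exact hf.add hg
  zero_mem' := by
    have h := weightedCoeff_smul r 0 0
    rw [zero_smul, zero_smul] at h
    simp only [Set.mem_ofPred_eq]
    rw [h]
    exact zero_memℓp
  smul_mem' c f hf := by
    simp only [Set.mem_ofPred_eq] at hf ⊢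
    rw [weightedCoeff_smul]
    exact hf.const_smul c

/-- The Sobolev space `H^r(S¹)` of real functions on the circle `S¹ = ℝ / ℤ`, for `r > 1/2`.
Its norm (below) is `‖f‖ = (∑ₙ (1 + n²)^r |f̂(n)|²)^{1/2}`, not the supremum norm. -/
def Sobolev (r : ℝ) : Type := sobolevSubmodule r

instance (r : ℝ) : AddCommGroup (Sobolev r) := inferInstanceAs (AddCommGroup (sobolevSubmodule r))

instance (r : ℝ) : Module ℝ (Sobolev r) := inferInstanceAs (Module ℝ (sobolevSubmodule r))

/-- The continuous function underlying an element of `H^r(S¹)`. -/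
def Sobolev.toContinuousMap {r : ℝ} (f : Sobolev r) : C(UnitAddCircle, ℝ) := Subtype.val f

/-- The linear map sending `f` to the square-summable sequence `(1 + n²)^{r/2} f̂(n)`. -/
def Sobolev.coeffs (r : ℝ) : Sobolev r →ₗ[ℝ] lp (fun _ : ℤ => ℂ) 2 where
  toFun f := ⟨weightedCoeff r f.toContinuousMap, f.2⟩
  map_add' f g := Subtype.ext (weightedCoeff_add r f.toContinuousMap g.toContinuousMap)
  map_smul' c f := Subtype.ext (weightedCoeff_smul r c f.toContinuousMap)

theorem eq_zero_of_fourierCoeff (F : C(UnitAddCircle, ℂ)) (hF : ∀ n, fourierCoeff F n = 0) :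
    F = 0 := by
  have h0 : fourierCoeff F = 0 := funext hF
  have hs : Summable (fourierCoeff F) := by
    rw [h0]
    exact summable_zero
  ext x
  have h3 := has_pointwise_sum_fourier_series_of_summable hs x
  have h4 : (fun i => fourierCoeff F i • fourier i x) = fun _ => (0 : ℂ) := by
    funext i
    rw [hF i, smul_eq_mul, zero_mul]
  rw [h4] at h3
  exact h3.unique hasSum_zero

theorem eq_zero_of_weightedCoeff (r : ℝ) (f : C(UnitAddCircle, ℝ)) (h0 : weightedCoeff r f = 0) :
    f = 0 := by
  have hF : ∀ n, fourierCoeff (fun x : UnitAddCircle => ((f x : ℝ) : ℂ)) n = 0 := by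
    intro n
    have h1 := congrFun h0 n
    simp only [weightedCoeff, Pi.zero_apply, mul_eq_zero] at h1
    refine h1.resolve_left fun h2 => ?_
    have h3 : (0 : ℝ) < (1 + (n : ℝ) ^ 2) ^ (r / 2) := by positivity
    exact h3.ne' (Complex.ofReal_eq_zero.mp h2)
  have h4 := eq_zero_of_fourierCoeff
    ⟨fun x => ((f x : ℝ) : ℂ), Complex.continuous_ofReal.comp f.continuous⟩ hF
  ext x
  exact Complex.ofReal_eq_zero.mp (DFunLike.congr_fun h4 x)

theorem Sobolev.coeffs_injective (r : ℝ) : Function.Injective (Sobolev.coeffs r) := by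
  rw [injective_iff_map_eq_zero]
  intro f hf
  exact Subtype.ext (eq_zero_of_weightedCoeff r f.toContinuousMap (congrArg Subtype.val hf))

instance (r : ℝ) : NormedAddCommGroup (Sobolev r) :=
  NormedAddCommGroup.induced _ _ (Sobolev.coeffs r) (Sobolev.coeffs_injective r)

instance (r : ℝ) : NormedSpace ℝ (Sobolev r) :=
  NormedSpace.induced ℝ _ _ (Sobolev.coeffs r)

/-- The `1`-periodic function on `ℝ` corresponding to `f ∈ H^r(S¹)`. -/
def Sobolev.lift {r : ℝ} (f : Sobolev r) (x : ℝ) : ℝ := f.toContinuousMap (x : UnitAddCircle)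

/-- The subspace `H₀^r(S¹)` of the functions `f ∈ H^r(S¹)` with `f(0) = 0`. -/
def Sobolev₀ (r : ℝ) : Submodule ℝ (Sobolev r) where
  carrier := {f | f.lift 0 = 0}
  add_mem' {f g} hf hg := by
    have h : (f + g).lift 0 = f.lift 0 + g.lift 0 := rfl
    simp only [Set.mem_ofPred_eq] at hf hg ⊢
    rw [h, hf, hg, add_zero]
  zero_mem' := rfl
  smul_mem' c f hf := by
    have h : (c • f).lift 0 = c * f.lift 0 := rfl
    simp only [Set.mem_ofPred_eq] at hf ⊢
    rw [h, hf, mul_zero]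

/-! ### The group `G^s` and its right-invariant metric -/

/-- The model space `H₀^s(S¹) × H^{s-1}(S¹)` of `G^s`, which is also its tangent space at every
point. -/
abbrev Model (s : ℝ) : Type := Sobolev₀ s × Sobolev (s - 1)

/-- The lift to `ℝ` of the circle map `φ` that is encoded by the first entry `h = φ - id` of
`p`: `φ(x) = x + h(x)`.  It satisfies `φ(0) = 0` and `φ(x + 1) = φ(x) + 1`. -/
def phi {s : ℝ} (p : Model s) (x : ℝ) : ℝ := x + (p.1 : Sobolev s).lift x

/-- `G^s = Diff₀^s(S¹) ⓢ H^{s-1}(S¹)`, in its global chart `(φ, α) ↦ (φ - id, α)`.  A circle map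
`φ` with `φ(0) = 0` and `φ - id ∈ H^s` is an orientation-preserving `H^s`-diffeomorphism if and
only if `φₓ > 0` everywhere, so `G^s` becomes an open subset of the model space, and
this chart defines its manifold structure. -/
def G (s : ℝ) : Set (Model s) := {p | ∀ x : ℝ, 0 < deriv (phi p) x}

/-- The form `¼ ∫ (u₁ₓ v₁ₓ + κ u₂ v₂) dx` on pairs of `1`-periodic functions: the metric at the
identity `(id, 0)`. -/
def metricId (κ : ℝ) (u v : (ℝ → ℝ) × (ℝ → ℝ)) : ℝ :=
  (1 / 4) * ∫ x in (0 : ℝ)..1, (deriv u.1 x * deriv v.1 x + κ * (u.2 x * v.2 x))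

/-- The tangent map `U ↦ (U₁ ∘ φ⁻¹, U₂ ∘ φ⁻¹)`, from the tangent space at `p = (φ, α)` to the one
at the identity, of the right translation by `p⁻¹` for the multiplication
`(φ, α) (ψ, β) = (φ ∘ ψ, β + α ∘ ψ)`. -/
def toIdentity {s : ℝ} (p U : Model s) : (ℝ → ℝ) × (ℝ → ℝ) :=
  ((U.1 : Sobolev s).lift ∘ Function.invFun (phi p), U.2.lift ∘ Function.invFun (phi p))

/-- The right-invariant metric `⟨U, V⟩_{(φ, α)}` on `G^s`. -/
def metric (κ : ℝ) {s : ℝ} (p U V : Model s) : ℝ :=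
  metricId κ (toIdentity p U) (toIdentity p V)

/-! ### Weak pseudo-Riemannian geometry on an open subset of a normed space -/

section Geometry

variable {E : Type*} [NormedAddCommGroup E] [NormedSpace ℝ E]

/-- `g` is a smooth weak pseudo-Riemannian metric on `M`: a smooth field of continuous symmetric
bilinear forms, each of them nondegenerate in the sense that `v ↦ g p v ·` is injective. -/
structure IsWeakPseudoRiemannian (M : Set E) (g : E → E → E → ℝ) : Prop where
  smooth : ∃ B : E → E →L[ℝ] E →L[ℝ] ℝ, ContDiffOn ℝ ∞ B M ∧
    ∀ p ∈ M, ∀ u v, B p u v = g p u v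
  symm : ∀ p ∈ M, ∀ u v, g p u v = g p v u
  nondegenerate : ∀ p ∈ M, ∀ u, (∀ v, g p u v = 0) → u = 0

/-- The connection `∇_X Y = DY · X + Γ(X, Y)` on `M` is smooth, torsion-free and compatible with
the metric `g` (it is enough to express this with constant vector fields): it is the Levi-Civita
connection of `g`. -/
structure IsLeviCivita (M : Set E) (g : E → E → E → ℝ) (Γ : E → E →L[ℝ] E →L[ℝ] E) : Prop where
  smooth : ContDiffOn ℝ ∞ Γ M
  torsionFree : ∀ p ∈ M, ∀ u v, Γ p u v = Γ p v u
  compatible : ∀ p ∈ M, ∀ u v w, DifferentiableAt ℝ (fun q => g q v w) p ∧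
    fderiv ℝ (fun q => g q v w) p u = g p (Γ p u v) w + g p v (Γ p u w)

/-- The curvature tensor `R(u, v) w = ∇_u ∇_v w - ∇_v ∇_u w - ∇_{[u, v]} w` of the connection
`∇_X Y = DY · X + Γ(X, Y)` at `p`, evaluated on the constant vector fields `u`, `v`, `w`, for
which `[u, v] = 0`. -/
def curvature (Γ : E → E →L[ℝ] E →L[ℝ] E) (p u v w : E) : E :=
  (fderiv ℝ Γ p u v w + Γ p u (Γ p v w)) - (fderiv ℝ Γ p v u w + Γ p v (Γ p u w))

/-- The number `⟨u, u⟩ ⟨v, v⟩ - ⟨u, v⟩²`; the plane spanned by `u` and `v` is nondegenerate if and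
only if it is nonzero. -/
def gram (g : E → E → E → ℝ) (p u v : E) : ℝ := g p u u * g p v v - g p u v ^ 2

/-- The sectional curvature `⟨R(u, v) v, u⟩ / (⟨u, u⟩ ⟨v, v⟩ - ⟨u, v⟩²)` of a nondegenerate
plane spanned by `u` and `v` at `p`. -/
def sectionalCurvature (g : E → E → E → ℝ) (Γ : E → E →L[ℝ] E →L[ℝ] E) (p u v : E) : ℝ :=
  g p (curvature Γ p u v v) u / gram g p u v

end Geometry

end

end HunterSaxton

namespace HunterSaxton

noncomputable section

/-! ### Square-summable sequences -/

/-! The substitution y = φ(x) turns the metric into ¼ ∫ (u₁ₓ v₁ₓ / φₓ - u₂ v₂ φₓ) dx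
(`metric_eq_integral`). This is the pullback of the flat form ∫ (da² - db²) under (φ, α) ↦ (a, b) =
√φₓ (cosh(α/2), sinh(α/2)). Since a² - b² = φₓ has integral 1, the image lies in the unit
pseudosphere of a flat space, which explains the constant curvature 1.

The proof stays in the chart and uses only the resulting formulas. In the coordinates (φₓ, α) the
flat connection acts pointwise on the circle. As in the Gauss formula for a sphere, the connection
of the pseudosphere adds ⟨u, v⟩ times the radial vector, whose first component in these coordinates
is 2φₓ. Integrating that component gives `christoffel`. Compatibility holds because the radial
correction contributes multiples of w₁ₓ and v₁ₓ, which have mean zero (`density_compatible`). A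
pointwise computation gives R(u, v)w = ⟨v, w⟩u - ⟨u, w⟩v (`curvature_christoffel`), hence sectional
curvature 1. The Koszul formula carries this over to every Levi-Civita connection
(`IsLeviCivita.eqOn`).

Nondegeneracy is only weak, so it does not by itself provide a connection; the explicit one must be
shown to be smooth on Sobolev spaces. For this H^{s-1} has to be a Banach algebra
(`norm_weightedCoeffC_mul_le`) in which nowhere vanishing functions are invertible. The latter is
Gelfand theory: all characters are point evaluations (`SobolevC.character_eq_eval`).
`CircleCalculus` isolates the facts that the geometry needs from the analysis. -/

theorem memℓp_two_iff_summable_sq {ι : Type*} {f : ι → ℂ} :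
    Memℓp f 2 ↔ Summable fun i => ‖f i‖ ^ 2 := by
  rw [memℓp_gen_iff (by norm_num)]
  simp

theorem lp_norm_sq_eq_tsum {ι : Type*} (f : lp (fun _ : ι => ℂ) 2) :
    ‖f‖ ^ 2 = ∑' i, ‖f i‖ ^ 2 := by
  have h := lp.norm_rpow_eq_tsum (p := 2) (by norm_num) f
  simpa using h

theorem lp_norm_le_of_hasSum {ι : Type*} {f : lp (fun _ : ι => ℂ) 2} {C : ℝ} (hC : 0 ≤ C)
    {b : ι → ℝ} (hb : Summable b) (hfb : ∀ i, ‖f i‖ ^ 2 ≤ b i) (hbC : ∑' i, b i ≤ C ^ 2) :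
    ‖f‖ ≤ C := by
  refine le_of_sq_le_sq ?_ hC
  rw [lp_norm_sq_eq_tsum]
  exact (Summable.tsum_le_tsum hfb (memℓp_two_iff_summable_sq.1 f.2) hb).trans hbC

/-! ### The Sobolev weights -/

/-- The weight `(1 + n²)^{r/2}`. -/
def weight (r : ℝ) (n : ℤ) : ℝ := (1 + (n : ℝ) ^ 2) ^ (r / 2)

theorem weight_pos (r : ℝ) (n : ℤ) : 0 < weight r n := by
  unfold weight; positivity

theorem weight_neg (r : ℝ) (n : ℤ) : weight r (-n) = weight r n := by
  simp [weight]

theorem weight_sq (r : ℝ) (n : ℤ) : weight r n ^ 2 = (1 + (n : ℝ) ^ 2) ^ r := by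
  rw [weight, ← Real.rpow_natCast, ← Real.rpow_mul (by positivity)]
  congr 1
  push_cast
  ring

/-- Comparison with ∑ |n|^{-2r}; this is where the threshold r > 1/2 comes from. -/
theorem summable_inv_weight_sq {r : ℝ} (hr : 1 / 2 < r) :
    Summable fun n : ℤ => (weight r n ^ 2)⁻¹ := by
  have h1 := Real.summable_abs_int_rpow (b := 2 * r) (by linarith)
  refine Summable.of_norm_bounded_eventually h1 ?_
  have h0 : ∀ᶠ n : ℤ in Filter.cofinite, n ≠ 0 := by
    simpa using (Set.finite_singleton (0 : ℤ)).compl_mem_cofinite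
  filter_upwards [h0] with n hn
  have hn' : 0 < |(n : ℝ)| := by positivity
  rw [weight_sq, Real.norm_of_nonneg (by positivity), Real.rpow_neg hn'.le]
  refine inv_anti₀ (by positivity) ?_
  rw [Real.rpow_mul hn'.le]
  refine Real.rpow_le_rpow (by positivity) ?_ (by linarith)
  simp

/-- The factor 4 comes from (m + k)² ≤ 4 max(m², k²). -/
theorem weight_sq_add_le {r : ℝ} (hr : 0 ≤ r) (m k : ℤ) :
    weight r (m + k) ^ 2 ≤ 4 ^ r * (weight r m ^ 2 + weight r k ^ 2) := by
  simp only [weight_sq]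
  push_cast
  rcases le_total ((m : ℝ) ^ 2) ((k : ℝ) ^ 2) with h | h
  · calc (1 + ((m : ℝ) + k) ^ 2) ^ r ≤ (4 * (1 + (k : ℝ) ^ 2)) ^ r := by
          refine Real.rpow_le_rpow (by positivity) ?_ hr
          nlinarith [sq_nonneg ((m : ℝ) - k)]
      _ = 4 ^ r * (1 + (k : ℝ) ^ 2) ^ r := Real.mul_rpow (by norm_num) (by positivity)
      _ ≤ _ := by
          have : 0 ≤ (1 + (m : ℝ) ^ 2) ^ r := by positivity
          gcongr
          linarith
  · calc (1 + ((m : ℝ) + k) ^ 2) ^ r ≤ (4 * (1 + (m : ℝ) ^ 2)) ^ r := by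
          refine Real.rpow_le_rpow (by positivity) ?_ hr
          nlinarith [sq_nonneg ((m : ℝ) - k)]
      _ = 4 ^ r * (1 + (m : ℝ) ^ 2) ^ r := Real.mul_rpow (by norm_num) (by positivity)
      _ ≤ _ := by
          have : 0 ≤ (1 + (k : ℝ) ^ 2) ^ r := by positivity
          gcongr
          linarith

/-- A bound for `∑ₘ w(n)² / (w(m)² w(n-m)²)` that does not depend on `n`. -/
def convConst (r : ℝ) : ℝ := 4 ^ r * (2 * ∑' n : ℤ, (weight r n ^ 2)⁻¹)

theorem convConst_pos {r : ℝ} (hr : 1 / 2 < r) : 0 < convConst r := by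
  have h : 0 < ∑' n : ℤ, (weight r n ^ 2)⁻¹ :=
    (summable_inv_weight_sq hr).tsum_pos (fun n => by positivity) 0
      (by have := weight_pos r 0; positivity)
  unfold convConst
  positivity

theorem sum_weight_quotient_le {r : ℝ} (hr : 1 / 2 < r) (n : ℤ) (t : Finset ℤ) :
    ∑ m ∈ t, weight r n ^ 2 * ((weight r m ^ 2)⁻¹ * (weight r (n - m) ^ 2)⁻¹) ≤ convConst r := by
  have hs := summable_inv_weight_sq hr
  have hs' : Summable fun m : ℤ => (weight r (n - m) ^ 2)⁻¹ :=
    hs.comp_injective (Equiv.subLeft n).injective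
  have ht : ∑' m : ℤ, (weight r (n - m) ^ 2)⁻¹ = ∑' m : ℤ, (weight r m ^ 2)⁻¹ :=
    (Equiv.subLeft n).tsum_eq fun m => (weight r m ^ 2)⁻¹
  calc ∑ m ∈ t, weight r n ^ 2 * ((weight r m ^ 2)⁻¹ * (weight r (n - m) ^ 2)⁻¹)
      ≤ ∑ m ∈ t, 4 ^ r * ((weight r m ^ 2)⁻¹ + (weight r (n - m) ^ 2)⁻¹) := by
        refine Finset.sum_le_sum fun m _ => ?_
        have h1 := weight_sq_add_le (r := r) (by linarith) m (n - m)
        rw [add_sub_cancel] at h1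
        have hm := weight_pos r m
        have hk := weight_pos r (n - m)
        calc _ ≤ (4 ^ r * (weight r m ^ 2 + weight r (n - m) ^ 2)) *
              ((weight r m ^ 2)⁻¹ * (weight r (n - m) ^ 2)⁻¹) := by gcongr
          _ = _ := by field_simp; ring
    _ = 4 ^ r * (∑ m ∈ t, (weight r m ^ 2)⁻¹ + ∑ m ∈ t, (weight r (n - m) ^ 2)⁻¹) := by
        rw [← Finset.mul_sum, Finset.sum_add_distrib]
    _ ≤ 4 ^ r * (∑' m : ℤ, (weight r m ^ 2)⁻¹ + ∑' m : ℤ, (weight r m ^ 2)⁻¹) := by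
        gcongr
        · exact hs.sum_le_tsum _ fun m _ => by positivity
        · rw [← ht]
          exact hs'.sum_le_tsum _ fun m _ => by positivity
    _ = convConst r := by rw [convConst, two_mul]

/-! ### Fourier coefficients of continuous functions -/

/-- The `n`-th Fourier coefficient as a continuous linear functional. -/
def fourierCoeffCLM (n : ℤ) : C(UnitAddCircle, ℂ) →L[ℂ] ℂ :=
  LinearMap.mkContinuous
    { toFun := fun F => fourierCoeff F n
      map_add' := fun F G => by
        have hi : ∀ F : C(UnitAddCircle, ℂ),
            MeasureTheory.Integrable F (AddCircle.haarAddCircle (T := (1 : ℝ))) := fun F =>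
          F.continuous.integrable_of_hasCompactSupport (HasCompactSupport.of_compactSpace _)
        exact congrFun (fourierCoeff.add (hi F) (hi G)) n
      map_smul' := fun c F => fourierCoeff.const_smul F c n } 1 fun F => by
    rw [one_mul]
    refine (MeasureTheory.norm_integral_le_of_norm_le_const (C := ‖F‖)
      (Filter.Eventually.of_forall fun x => ?_)).trans ?_
    · rw [norm_smul, fourier_apply, Circle.norm_coe, one_mul]
      exact F.norm_coe_le_norm x
    · simp

theorem fourierCoeffCLM_apply (n : ℤ) (F : C(UnitAddCircle, ℂ)) :
    fourierCoeffCLM n F = fourierCoeff F n := rfl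

theorem continuousMap_ext_fourierCoeff {F G : C(UnitAddCircle, ℂ)}
    (h : ∀ n, fourierCoeff F n = fourierCoeff G n) : F = G := by
  rw [← sub_eq_zero]
  refine eq_zero_of_fourierCoeff _ fun n => ?_
  rw [← fourierCoeffCLM_apply, map_sub, fourierCoeffCLM_apply, fourierCoeffCLM_apply, h, sub_self]

theorem fourierCoeff_mul {F G : C(UnitAddCircle, ℂ)} (hF : Summable (fourierCoeff F)) (n : ℤ) :
    HasSum (fun m => fourierCoeff F m * fourierCoeff G (n - m)) (fourierCoeff (F * G) n) := by
  have h := (fourierCoeffCLM n).hasSum ((hasSum_fourier_series_of_summable hF).mul_right G)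
  have h2 : ∀ m, fourierCoeffCLM n ((fourierCoeff F m • fourier m) * G)
      = fourierCoeff F m * fourierCoeff G (n - m) := by
    intro m
    rw [smul_mul_assoc, map_smul, smul_eq_mul, fourierCoeffCLM_apply]
    congr 1
    unfold fourierCoeff
    congr 1
    funext x
    rw [neg_sub, sub_eq_add_neg, add_comm, fourier_add, ContinuousMap.mul_apply, smul_eq_mul,
      smul_eq_mul, mul_assoc]
  simp only [h2] at h
  exact h

/-- The sum of an absolutely convergent Fourier series. -/
def fourierSeries (c : ℤ → ℂ) : C(UnitAddCircle, ℂ) := ∑' n, c n • fourier n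

theorem summable_fourierSeries {c : ℤ → ℂ} (hc : Summable c) :
    Summable fun n => c n • (fourier n : C(UnitAddCircle, ℂ)) := by
  refine Summable.of_norm ?_
  simpa [norm_smul, fourier_norm] using hc.norm

theorem fourierCoeff_fourierSeries {c : ℤ → ℂ} (hc : Summable c) (n : ℤ) :
    fourierCoeff (fourierSeries c) n = c n := by
  have h := (fourierCoeffCLM n).hasSum (summable_fourierSeries hc).hasSum
  have h2 : ∀ m, fourierCoeffCLM n (c m • fourier m) = if m = n then c n else 0 := by
    intro m
    rw [map_smul, fourierCoeffCLM_apply, fourierCoeff_fourier, smul_eq_mul, Pi.single_apply]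
    by_cases hmn : m = n
    · simp [hmn]
    · simp [hmn, Ne.symm hmn]
  have h3 : HasSum (fun m => fourierCoeffCLM n (c m • fourier m)) (c n) := by
    simpa only [h2] using hasSum_ite_eq n (c n)
  exact h.unique h3

/-- The weighted Fourier coefficients `(1 + n²)^{r/2} F̂(n)` of a complex continuous function. -/
def weightedCoeffC (r : ℝ) (F : C(UnitAddCircle, ℂ)) (n : ℤ) : ℂ :=
  (weight r n : ℂ) * fourierCoeff F n

theorem norm_weightedCoeffC (r : ℝ) (F : C(UnitAddCircle, ℂ)) (n : ℤ) :
    ‖weightedCoeffC r F n‖ = weight r n * ‖fourierCoeff F n‖ := by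
  rw [weightedCoeffC, norm_mul, Complex.norm_real, Real.norm_of_nonneg (weight_pos r n).le]

/-! ### Multiplication in `H^r` for r > 1/2. -/

theorem summable_norm_div_weight {r : ℝ} (hr : 1 / 2 < r) {b : ℤ → ℂ} (hb : Memℓp b 2) :
    Summable fun n => ‖b n‖ * (weight r n)⁻¹ := by
  refine Summable.of_nonneg_of_le (fun n => ?_) (fun n => ?_)
    ((memℓp_two_iff_summable_sq.1 hb).add (summable_inv_weight_sq hr))
  · have := weight_pos r n
    positivity
  · rw [← inv_pow]
    nlinarith [sq_nonneg (‖b n‖ - (weight r n)⁻¹), sq_nonneg ‖b n‖, sq_nonneg (weight r n)⁻¹]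

theorem summable_fourierCoeff {r : ℝ} (hr : 1 / 2 < r) {F : C(UnitAddCircle, ℂ)}
    (hF : Memℓp (weightedCoeffC r F) 2) : Summable (fourierCoeff F) := by
  refine Summable.of_norm ((summable_norm_div_weight hr hF).congr fun n => ?_)
  have := weight_pos r n
  rw [norm_weightedCoeffC]
  field_simp

/-- Cauchy–Schwarz for the convolution, after extracting the factor w(n) / (w(m) w(n - m)) from each
term. The squares of these factors have sum at most `convConst r`, uniformly in n. The estimate is
made for finite partial sums and passes to the limit. -/
theorem norm_weightedCoeffC_mul_sq_le {r : ℝ} (hr : 1 / 2 < r) {F G : C(UnitAddCircle, ℂ)}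
    (hF : Memℓp (weightedCoeffC r F) 2) (hG : Memℓp (weightedCoeffC r G) 2) (n : ℤ) :
    ‖weightedCoeffC r (F * G) n‖ ^ 2 ≤
      convConst r *
        ∑' m, ‖weightedCoeffC r F m‖ ^ 2 * ‖weightedCoeffC r G (n - m)‖ ^ 2 := by
  have hsF := memℓp_two_iff_summable_sq.1 hF
  have hsG : Summable fun m => ‖weightedCoeffC r G (n - m)‖ ^ 2 :=
    (memℓp_two_iff_summable_sq.1 hG).comp_injective (Equiv.subLeft n).injective
  have hs : Summable fun m => ‖weightedCoeffC r F m‖ ^ 2 * ‖weightedCoeffC r G (n - m)‖ ^ 2 := by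
    have hGb : ∀ m, ‖weightedCoeffC r G (n - m)‖ ^ 2 ≤
        ∑' m, ‖weightedCoeffC r G (n - m)‖ ^ 2 := fun m =>
      hsG.le_tsum m fun _ _ => by positivity
    refine Summable.of_nonneg_of_le (fun m => by positivity) (fun m => ?_)
      (hsF.mul_right (∑' m, ‖weightedCoeffC r G (n - m)‖ ^ 2))
    exact mul_le_mul_of_nonneg_left (hGb m) (by positivity)
  have hsum := fourierCoeff_mul (G := G) (summable_fourierCoeff hr hF) n
  have hlim := ((hsum.mul_left (weight r n : ℂ)).norm.pow 2)
  refine le_of_tendsto hlim (Filter.Eventually.of_forall fun t => ?_)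
  have h1 : ‖∑ m ∈ t, (weight r n : ℂ) * (fourierCoeff F m * fourierCoeff G (n - m))‖ ≤
      ∑ m ∈ t, (weight r n * ((weight r m)⁻¹ * (weight r (n - m))⁻¹)) *
        (‖weightedCoeffC r F m‖ * ‖weightedCoeffC r G (n - m)‖) := by
    refine (norm_sum_le _ _).trans (Finset.sum_le_sum fun m _ => le_of_eq ?_)
    have h1 := weight_pos r m
    have h2 := weight_pos r (n - m)
    rw [norm_mul, norm_mul, norm_weightedCoeffC, norm_weightedCoeffC, Complex.norm_real,
      Real.norm_of_nonneg (weight_pos r n).le]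
    field_simp
  calc ‖∑ m ∈ t, (weight r n : ℂ) * (fourierCoeff F m * fourierCoeff G (n - m))‖ ^ 2
      ≤ (∑ m ∈ t, (weight r n * ((weight r m)⁻¹ * (weight r (n - m))⁻¹)) *
        (‖weightedCoeffC r F m‖ * ‖weightedCoeffC r G (n - m)‖)) ^ 2 := by gcongr
    _ ≤ (∑ m ∈ t, (weight r n * ((weight r m)⁻¹ * (weight r (n - m))⁻¹)) ^ 2) *
        ∑ m ∈ t, (‖weightedCoeffC r F m‖ * ‖weightedCoeffC r G (n - m)‖) ^ 2 :=
        Finset.sum_mul_sq_le_sq_mul_sq _ _ _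
    _ ≤ _ := by
        refine mul_le_mul ?_ ?_ (Finset.sum_nonneg fun _ _ => by positivity)
          (convConst_pos hr).le
        · simpa only [mul_pow, inv_pow] using sum_weight_quotient_le hr n t
        · simp only [mul_pow]
          exact hs.sum_le_tsum _ fun m _ => by positivity

/-- Fubini after the shear (n, m) ↦ (m, n - m). It is applied to the squared moduli of weighted
coefficients. -/
theorem summable_convolution_sq {a b : ℤ → ℝ} (ha : Summable a) (hb : Summable b)
    (ha0 : ∀ n, 0 ≤ a n) (hb0 : ∀ n, 0 ≤ b n) :
    HasSum (fun n => ∑' m, a m * b (n - m)) ((∑' n, a n) * ∑' n, b n) := by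
  have h1 : Summable fun x : ℤ × ℤ => a x.1 * b x.2 := ha.mul_of_nonneg hb ha0 hb0
  let e : ℤ × ℤ ≃ ℤ × ℤ :=
    { toFun := fun x => (x.2, x.1 - x.2)
      invFun := fun x => (x.1 + x.2, x.1)
      left_inv := fun x => by simp
      right_inv := fun x => by simp }
  have h2 : Summable fun x : ℤ × ℤ => a x.2 * b (x.1 - x.2) := e.summable_iff.2 h1
  have h3 : ∑' x : ℤ × ℤ, a x.2 * b (x.1 - x.2) = ∑' x : ℤ × ℤ, a x.1 * b x.2 :=
    e.tsum_eq fun x : ℤ × ℤ => a x.1 * b x.2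
  rw [ha.tsum_mul_tsum hb h1, ← h3, h2.tsum_prod]
  exact h2.prod.hasSum

theorem hasSum_convolution_weightedCoeffC {r : ℝ} {F G : C(UnitAddCircle, ℂ)}
    (hF : Memℓp (weightedCoeffC r F) 2) (hG : Memℓp (weightedCoeffC r G) 2) :
    HasSum (fun n => convConst r *
        ∑' m, ‖weightedCoeffC r F m‖ ^ 2 * ‖weightedCoeffC r G (n - m)‖ ^ 2)
      (convConst r * ((∑' n, ‖weightedCoeffC r F n‖ ^ 2) * ∑' n, ‖weightedCoeffC r G n‖ ^ 2)) :=
  (summable_convolution_sq (memℓp_two_iff_summable_sq.1 hF) (memℓp_two_iff_summable_sq.1 hG)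
    (fun n => by positivity) fun n => by positivity).mul_left _

theorem memℓp_weightedCoeffC_mul {r : ℝ} (hr : 1 / 2 < r) {F G : C(UnitAddCircle, ℂ)}
    (hF : Memℓp (weightedCoeffC r F) 2) (hG : Memℓp (weightedCoeffC r G) 2) :
    Memℓp (weightedCoeffC r (F * G)) 2 := by
  rw [memℓp_two_iff_summable_sq]
  exact Summable.of_nonneg_of_le (fun n => by positivity)
    (norm_weightedCoeffC_mul_sq_le hr hF hG) (hasSum_convolution_weightedCoeffC hF hG).summable

/-- `H^r` is closed under multiplication for `r > 1/2`, with a bound. -/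
theorem norm_weightedCoeffC_mul_le {r : ℝ} (hr : 1 / 2 < r) {F G : C(UnitAddCircle, ℂ)}
    {a b c : lp (fun _ : ℤ => ℂ) 2} (ha : ∀ n, a n = weightedCoeffC r F n)
    (hb : ∀ n, b n = weightedCoeffC r G n) (hc : ∀ n, c n = weightedCoeffC r (F * G) n) :
    ‖c‖ ≤ √(convConst r) * ‖a‖ * ‖b‖ := by
  have hF : Memℓp (weightedCoeffC r F) 2 := by
    rw [← funext ha]; exact a.2
  have hG : Memℓp (weightedCoeffC r G) 2 := by
    rw [← funext hb]; exact b.2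
  have h := hasSum_convolution_weightedCoeffC hF hG
  refine lp_norm_le_of_hasSum (by positivity) h.summable (fun n => ?_) ?_
  · rw [hc]
    exact norm_weightedCoeffC_mul_sq_le hr hF hG n
  · rw [h.tsum_eq, mul_pow, mul_pow, Real.sq_sqrt (convConst_pos hr).le, lp_norm_sq_eq_tsum,
      lp_norm_sq_eq_tsum]
    simp only [ha, hb, mul_assoc, le_refl]

/-! ### The Banach algebra of complex Sobolev functions and its characters -/

section ComplexSobolev

theorem memℓp_weightedCoeffC_fourier (r : ℝ) (k : ℤ) :
    Memℓp (weightedCoeffC r (fourier k)) 2 := by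
  have h : weightedCoeffC r (fourier k)
      = ⇑(lp.single (E := fun _ : ℤ => ℂ) 2 k (weight r k : ℂ)) := by
    funext n
    rw [weightedCoeffC, fourierCoeff_fourier, lp.single_apply, Pi.single_apply, Pi.single_apply]
    split_ifs with hnk
    · rw [hnk, mul_one]
    · rw [mul_zero]
  rw [h]
  exact lp.memℓp _

theorem fourier_zero_eq_one : (fourier 0 : C(UnitAddCircle, ℂ)) = 1 := by
  ext x
  simp

/-- The algebra `H^r(S¹; ℂ)`, for `r > 1/2`. -/
def sobolevSubalgebra (r : ℝ) (hr : 1 / 2 < r) : Subalgebra ℂ C(UnitAddCircle, ℂ) where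
  carrier := {F | Memℓp (weightedCoeffC r F) 2}
  mul_mem' hF hG := memℓp_weightedCoeffC_mul hr hF hG
  add_mem' {F G} hF hG := by
    have h : weightedCoeffC r (F + G) = weightedCoeffC r F + weightedCoeffC r G := by
      funext n
      simp only [weightedCoeffC, Pi.add_apply]
      rw [← fourierCoeffCLM_apply, map_add, mul_add]
      rfl
    simp only [Set.mem_ofPred_eq] at hF hG ⊢
    rw [h]
    exact hF.add hG
  algebraMap_mem' c := by
    have h : weightedCoeffC r (algebraMap ℂ C(UnitAddCircle, ℂ) c)
        = c • weightedCoeffC r (fourier 0) := by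
      funext n
      simp only [weightedCoeffC, Pi.smul_apply]
      rw [← fourierCoeffCLM_apply, Algebra.algebraMap_eq_smul_one, ← fourier_zero_eq_one, map_smul,
        smul_eq_mul, smul_eq_mul, mul_left_comm]
      rfl
    simp only [Set.mem_ofPred_eq]
    rw [h]
    exact (memℓp_weightedCoeffC_fourier r 0).const_smul c

/-- The type of elements of `H^r(S¹; ℂ)`, which carries a submultiplicative norm. -/
def SobolevC (r : ℝ) (hr : 1 / 2 < r) : Type := sobolevSubalgebra r hr

variable {r : ℝ} {hr : 1 / 2 < r}

instance : CommRing (SobolevC r hr) := inferInstanceAs (CommRing (sobolevSubalgebra r hr))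

instance : Algebra ℂ (SobolevC r hr) := inferInstanceAs (Algebra ℂ (sobolevSubalgebra r hr))

/-- The inclusion of `H^r(S¹; ℂ)` into the continuous functions. -/
def SobolevC.val : SobolevC r hr →ₐ[ℂ] C(UnitAddCircle, ℂ) := (sobolevSubalgebra r hr).val

theorem SobolevC.val_injective : Function.Injective (SobolevC.val (hr := hr)) :=
  Subtype.val_injective

theorem SobolevC.memℓp (f : SobolevC r hr) : Memℓp (weightedCoeffC r f.val) 2 := f.2

/-- The linear equivalence of `H^r(S¹; ℂ)` with the square-summable sequences. -/
def SobolevC.coeffs (r : ℝ) (hr : 1 / 2 < r) : SobolevC r hr ≃ₗ[ℂ] lp (fun _ : ℤ => ℂ) 2 where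
  toFun f := ⟨weightedCoeffC r f.val, f.2⟩
  map_add' f g := by
    ext n
    change _ * fourierCoeffCLM n _ = _ * fourierCoeffCLM n _ + _ * fourierCoeffCLM n _
    rw [map_add, map_add, mul_add]
  map_smul' c f := by
    ext n
    change _ * fourierCoeffCLM n _ = c • (_ * fourierCoeffCLM n _)
    rw [map_smul, map_smul, smul_eq_mul, smul_eq_mul, mul_left_comm]
  invFun b := ⟨fourierSeries fun n => (weight r n : ℂ)⁻¹ * b n, by
    have h : weightedCoeffC r (fourierSeries fun n => (weight r n : ℂ)⁻¹ * b n) = b := by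
      funext n
      have h0 : (weight r n : ℂ) ≠ 0 := Complex.ofReal_ne_zero.2 (weight_pos r n).ne'
      rw [weightedCoeffC, fourierCoeff_fourierSeries, mul_inv_cancel_left₀ h0]
      refine Summable.of_norm ((summable_norm_div_weight hr b.2).congr fun n => ?_)
      rw [norm_mul, norm_inv, Complex.norm_real, Real.norm_of_nonneg (weight_pos r n).le, mul_comm]
    simp only [sobolevSubalgebra, Subalgebra.mem_mk, Subsemiring.mem_mk, Submonoid.mem_mk,
      Subsemigroup.mem_mk, Set.mem_ofPred_eq]
    change Memℓp (weightedCoeffC r _) 2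
    rw [h]
    exact b.2⟩
  left_inv f := by
    refine SobolevC.val_injective (continuousMap_ext_fourierCoeff fun n => ?_)
    change fourierCoeff (fourierSeries fun n => (weight r n : ℂ)⁻¹ *
      ((weight r n : ℂ) * fourierCoeff f.val n)) n = _
    have h : (fun n => (weight r n : ℂ)⁻¹ * ((weight r n : ℂ) * fourierCoeff f.val n))
        = fourierCoeff f.val := by
      funext n
      exact inv_mul_cancel_left₀ (Complex.ofReal_ne_zero.2 (weight_pos r n).ne') _
    rw [h, fourierCoeff_fourierSeries (summable_fourierCoeff hr f.memℓp)]
  right_inv b := by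
    ext n
    have h0 : (weight r n : ℂ) ≠ 0 := Complex.ofReal_ne_zero.2 (weight_pos r n).ne'
    change (weight r n : ℂ) * fourierCoeff (fourierSeries _) n = _
    rw [fourierCoeff_fourierSeries, mul_inv_cancel_left₀ h0]
    refine Summable.of_norm ((summable_norm_div_weight hr b.2).congr fun n => ?_)
    rw [norm_mul, norm_inv, Complex.norm_real, Real.norm_of_nonneg (weight_pos r n).le, mul_comm]

theorem SobolevC.coeffs_apply (f : SobolevC r hr) (n : ℤ) :
    SobolevC.coeffs r hr f n = weightedCoeffC r f.val n := rfl

/-- The coefficient map, scaled so that the induced norm is submultiplicative. -/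
def SobolevC.scaledCoeffs (r : ℝ) (hr : 1 / 2 < r) : SobolevC r hr ≃ₗ[ℂ] lp (fun _ : ℤ => ℂ) 2 :=
  (SobolevC.coeffs r hr).trans (LinearEquiv.smulOfNeZero ℂ _ ((√(convConst r) : ℝ) : ℂ)
    (Complex.ofReal_ne_zero.2 (Real.sqrt_pos.2 (convConst_pos hr)).ne'))

theorem SobolevC.scaledCoeffs_apply (f : SobolevC r hr) :
    SobolevC.scaledCoeffs r hr f = ((√(convConst r) : ℝ) : ℂ) • SobolevC.coeffs r hr f := rfl

instance : NormedAddCommGroup (SobolevC r hr) :=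
  NormedAddCommGroup.induced _ _ (SobolevC.scaledCoeffs r hr) (SobolevC.scaledCoeffs r hr).injective

theorem SobolevC.norm_def (f : SobolevC r hr) :
    ‖f‖ = √(convConst r) * ‖SobolevC.coeffs r hr f‖ := by
  change ‖SobolevC.scaledCoeffs r hr f‖ = _
  rw [SobolevC.scaledCoeffs_apply, norm_smul, Complex.norm_real,
    Real.norm_of_nonneg (Real.sqrt_nonneg _)]

instance : NormedCommRing (SobolevC r hr) where
  norm_mul_le f g := by
    rw [SobolevC.norm_def, SobolevC.norm_def, SobolevC.norm_def]
    have h := norm_weightedCoeffC_mul_le hr (SobolevC.coeffs_apply f) (SobolevC.coeffs_apply g)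
      (SobolevC.coeffs_apply (f * g))
    have h0 := Real.sqrt_nonneg (convConst r)
    calc _ ≤ √(convConst r) * (√(convConst r) * ‖SobolevC.coeffs r hr f‖ *
          ‖SobolevC.coeffs r hr g‖) := by gcongr
      _ = _ := by ring
  mul_comm := mul_comm
  dist_eq := dist_eq_norm_neg_add

instance : NormedAlgebra ℂ (SobolevC r hr) where
  norm_smul_le c f := by
    change ‖SobolevC.scaledCoeffs r hr _‖ ≤ ‖c‖ * ‖SobolevC.scaledCoeffs r hr f‖
    rw [map_smul, norm_smul]

/-- The isometry of `H^r(S¹; ℂ)` with `ℓ²`. -/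
def SobolevC.isometryEquiv (r : ℝ) (hr : 1 / 2 < r) :
    SobolevC r hr ≃ₗᵢ[ℂ] lp (fun _ : ℤ => ℂ) 2 where
  toLinearEquiv := SobolevC.scaledCoeffs r hr
  norm_map' _ := rfl

/-- Completeness makes this a Banach algebra, as required for the existence of characters in
`SobolevC.isUnit_of_forall_ne_zero`. -/
instance : CompleteSpace (SobolevC r hr) :=
  (SobolevC.isometryEquiv r hr).toIsometryEquiv.completeSpace

/-- The exponential `e^{2πinx}` as an element of `H^r(S¹; ℂ)`. -/
def SobolevC.exp (r : ℝ) (hr : 1 / 2 < r) (n : ℤ) : SobolevC r hr :=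
  ⟨fourier n, memℓp_weightedCoeffC_fourier r n⟩

theorem SobolevC.val_exp (n : ℤ) : (SobolevC.exp r hr n).val = fourier n := rfl

theorem SobolevC.exp_zero : SobolevC.exp r hr 0 = 1 :=
  SobolevC.val_injective (by rw [SobolevC.val_exp, map_one, fourier_zero_eq_one])

theorem SobolevC.exp_add (m n : ℤ) :
    SobolevC.exp r hr (m + n) = SobolevC.exp r hr m * SobolevC.exp r hr n :=
  SobolevC.val_injective (by ext x; rw [map_mul, SobolevC.val_exp]; exact fourier_add)

theorem SobolevC.exp_nsmul (k : ℕ) (n : ℤ) :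
    SobolevC.exp r hr (k * n) = SobolevC.exp r hr n ^ k := by
  induction k with
  | zero => simp [SobolevC.exp_zero]
  | succ k ih =>
    rw [pow_succ, ← ih, ← SobolevC.exp_add]
    congr 1
    push_cast
    ring

theorem SobolevC.coeffs_exp (n : ℤ) :
    SobolevC.coeffs r hr (SobolevC.exp r hr n) = lp.single 2 n (weight r n : ℂ) := by
  ext k
  rw [SobolevC.coeffs_apply, SobolevC.val_exp, weightedCoeffC, fourierCoeff_fourier,
    lp.single_apply, Pi.single_apply, Pi.single_apply]
  split_ifs with hnk
  · rw [hnk, mul_one]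
  · rw [mul_zero]

theorem SobolevC.norm_exp (n : ℤ) :
    ‖SobolevC.exp r hr n‖ = √(convConst r) * weight r n := by
  rw [SobolevC.norm_def, SobolevC.coeffs_exp, lp.norm_single (by norm_num), Complex.norm_real,
    Real.norm_of_nonneg (weight_pos r n).le]

/-- The convergence is in the norm of `H^r`, so a continuous functional is determined by its values
on the exponentials. -/
theorem SobolevC.hasSum_exp (f : SobolevC r hr) :
    HasSum (fun n => fourierCoeff f.val n • SobolevC.exp r hr n) f := by
  rw [← (SobolevC.isometryEquiv r hr).toContinuousLinearEquiv.hasSum']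
  have h : ∀ n, (SobolevC.isometryEquiv r hr).toContinuousLinearEquiv
      (fourierCoeff f.val n • SobolevC.exp r hr n)
      = lp.single 2 n (SobolevC.isometryEquiv r hr f n) := by
    intro n
    change SobolevC.scaledCoeffs r hr _ = lp.single 2 n (SobolevC.scaledCoeffs r hr f n)
    rw [map_smul, SobolevC.scaledCoeffs_apply, SobolevC.scaledCoeffs_apply, SobolevC.coeffs_exp,
      smul_comm, lp.coeFn_smul, Pi.smul_apply, lp.single_smul, SobolevC.coeffs_apply,
      weightedCoeffC, ← lp.single_smul 2 n (fourierCoeff f.val n), smul_eq_mul, mul_comm]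
  simp only [h]
  exact lp.hasSum_single (by norm_num) _

/-! ### Characters of the Sobolev algebra. -/

theorem exists_nat_weight_le (r : ℝ) : ∃ k : ℕ, ∀ n : ℕ, weight r n ≤ (n + 1 : ℝ) ^ k := by
  obtain ⟨k, hk⟩ := exists_nat_ge r
  refine ⟨k, fun n => ?_⟩
  have h1 : (1 : ℝ) ≤ n + 1 := by linarith [n.cast_nonneg (α := ℝ)]
  calc weight r n ≤ (((n : ℝ) + 1) ^ 2) ^ ((k : ℝ) / 2) := by
        unfold weight
        push_cast
        have h2 : 1 + (n : ℝ) ^ 2 ≤ ((n : ℝ) + 1) ^ 2 := by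
          nlinarith [n.cast_nonneg (α := ℝ)]
        calc (1 + (n : ℝ) ^ 2) ^ (r / 2) ≤ (1 + (n : ℝ) ^ 2) ^ ((k : ℝ) / 2) :=
              Real.rpow_le_rpow_of_exponent_le (by nlinarith) (by linarith)
          _ ≤ _ := Real.rpow_le_rpow (by positivity) h2 (by positivity)
    _ = (n + 1 : ℝ) ^ k := by
        rw [← Real.rpow_natCast _ 2, ← Real.rpow_mul (by linarith)]
        rw [← Real.rpow_natCast _ k]
        congr 1
        push_cast
        ring

/-- The weights grow only polynomially, whereas the powers of a number x > 1 grow exponentially. -/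
theorem norm_le_one_of_pow_le {C x : ℝ} (hC : ∀ n : ℕ, x ^ n ≤ C * weight r n) :
    x ≤ 1 := by
  by_contra! h
  obtain ⟨k, hk⟩ := exists_nat_weight_le r
  have hlim := (tendsto_pow_const_div_const_pow_of_one_lt k h).comp (Filter.tendsto_add_atTop_nat 1)
  have hlim2 := hlim.const_mul (|C| * x)
  rw [mul_zero] at hlim2
  -- The extra factor x compensates for the shift of the exponent from n to n + 1 in the sequence
  -- tending to 0.
  have h1 : ∀ n : ℕ, 1 ≤ |C| * x * (((n + 1 : ℕ) : ℝ) ^ k / x ^ (n + 1)) := by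
    intro n
    have hxn : 0 < x ^ n := by positivity
    have h2 : x ^ n ≤ |C| * ((n : ℝ) + 1) ^ k := by
      refine (hC n).trans ?_
      have := weight_pos r n
      exact mul_le_mul (le_abs_self C) (hk n) this.le (abs_nonneg C)
    have h3 : |C| * x * (((n + 1 : ℕ) : ℝ) ^ k / x ^ (n + 1))
        = |C| * ((n : ℝ) + 1) ^ k / x ^ n := by
      push_cast
      field_simp
      ring
    rw [h3, le_div_iff₀ hxn, one_mul]
    exact h2
  have h2 := ge_of_tendsto hlim2 (Filter.Eventually.of_forall h1)
  linarith

/-- The characters of `H^r(S¹; ℂ)` are the evaluations at points of the circle. -/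
theorem SobolevC.character_eq_eval (χ : WeakDual.characterSpace ℂ (SobolevC r hr)) :
    ∃ x : UnitAddCircle, ∀ f : SobolevC r hr, χ f = f.val x := by
  set φ : SobolevC r hr →L[ℂ] ℂ := WeakDual.CharacterSpace.toCLM χ with hφ
  have hφa : ∀ f, φ f = χ f := fun f => rfl
  -- The k-th power of χ(eₙ) is χ(e_{kn}), and the norm of e_{kn} is polynomially bounded in k. So
  -- χ(e₁) and its inverse χ(e₋₁) both have modulus at most 1, and χ(e₁) lies on the unit circle.
  have hbound : ∀ n : ℤ, ∀ k : ℕ, ‖χ (SobolevC.exp r hr n)‖ ^ k ≤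
      ‖φ‖ * (√(convConst r) * weight r (k * n)) := by
    intro n k
    rw [← norm_pow, ← map_pow, ← SobolevC.exp_nsmul, ← SobolevC.norm_exp (hr := hr)]
    exact φ.le_opNorm _
  have h1 : ‖χ (SobolevC.exp r hr 1)‖ ≤ 1 := by
    refine norm_le_one_of_pow_le (r := r) (C := ‖φ‖ * √(convConst r)) fun k => ?_
    simpa [mul_assoc] using hbound 1 k
  have h2 : ‖χ (SobolevC.exp r hr (-1))‖ ≤ 1 := by
    refine norm_le_one_of_pow_le (r := r) (C := ‖φ‖ * √(convConst r)) fun k => ?_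
    have := hbound (-1) k
    rw [mul_neg, mul_one, weight_neg] at this
    simpa [mul_assoc] using this
  have h3 : χ (SobolevC.exp r hr 1) * χ (SobolevC.exp r hr (-1)) = 1 := by
    rw [← map_mul, ← SobolevC.exp_add, add_neg_cancel, SobolevC.exp_zero, map_one]
  have h4 : ‖χ (SobolevC.exp r hr 1)‖ = 1 := by
    refine le_antisymm h1 ?_
    have := congrArg norm h3
    rw [norm_mul, norm_one] at this
    nlinarith [norm_nonneg (χ (SobolevC.exp r hr 1))]
  obtain ⟨x, hx⟩ := (AddCircle.homeomorphCircle (one_ne_zero (α := ℝ))).surjective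
    ⟨χ (SobolevC.exp r hr 1), mem_sphere_zero_iff_norm.2 h4⟩
  have hx1 : χ (SobolevC.exp r hr 1) = fourier 1 x := by
    rw [fourier_one]
    have h5 := congrArg Subtype.val hx
    rw [AddCircle.homeomorphCircle_apply] at h5
    exact h5.symm
  have hxm : χ (SobolevC.exp r hr (-1)) = fourier (-1) x := by
    have h5 : (fourier 1 x : ℂ) * fourier (-1) x = 1 := by
      rw [← fourier_add, add_neg_cancel, fourier_zero]
    have h6 : (fourier 1 x : ℂ) ≠ 0 := left_ne_zero_of_mul_eq_one h5
    refine mul_left_cancel₀ h6 ?_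
    rw [h5, ← hx1, h3]
  have hpow : ∀ (k : ℕ) (n : ℤ), (fourier (k * n) x : ℂ) = fourier n x ^ k := by
    intro k n
    have := congrArg (fun f => f.val x) (SobolevC.exp_nsmul (r := r) (hr := hr) k n)
    simpa [SobolevC.val_exp] using this
  have hn : ∀ n : ℤ, χ (SobolevC.exp r hr n) = fourier n x := by
    intro n
    obtain ⟨k, rfl | rfl⟩ := n.eq_nat_or_neg
    · have := SobolevC.exp_nsmul (r := r) (hr := hr) k 1
      rw [mul_one] at this
      rw [this, map_pow, hx1, ← hpow, mul_one]
    · have := SobolevC.exp_nsmul (r := r) (hr := hr) k (-1)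
      rw [mul_neg, mul_one] at this
      rw [this, map_pow, hxm, ← hpow, mul_neg, mul_one]
  refine ⟨x, fun f => ?_⟩
  -- χ agrees with evaluation at x on all exponentials; continuity extends this along the Fourier
  -- series.
  have h5 := φ.hasSum (SobolevC.hasSum_exp f)
  have h6 : ∀ n, φ (fourierCoeff f.val n • SobolevC.exp r hr n)
      = fourierCoeff f.val n • fourier n x := by
    intro n
    rw [map_smul, hφa, hn]
  simp only [h6] at h5
  exact h5.unique (has_pointwise_sum_fourier_series_of_summable
    (summable_fourierCoeff hr f.memℓp) x)

/-- Wiener's lemma for Sobolev spaces: a nowhere vanishing function in `H^r(S¹; ℂ)` has its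
reciprocal in `H^r(S¹; ℂ)`. -/
theorem SobolevC.isUnit_of_forall_ne_zero (f : SobolevC r hr) (hf : ∀ x, f.val x ≠ 0) :
    IsUnit f := by
  by_contra h
  -- In a commutative Banach algebra every non-unit is annihilated by some character.
  obtain ⟨χ, hχ⟩ := WeakDual.CharacterSpace.exists_apply_eq_zero h
  obtain ⟨x, hx⟩ := SobolevC.character_eq_eval χ
  exact hf x (by rw [← hx, hχ])

end ComplexSobolev

/-! ### Real Sobolev functions and their Fourier coefficients -/

/-- A real continuous function, regarded as a complex one. -/
def complexify (f : C(UnitAddCircle, ℝ)) : C(UnitAddCircle, ℂ) :=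
  ⟨fun x => ((f x : ℝ) : ℂ), Complex.continuous_ofReal.comp f.continuous⟩

theorem complexify_apply (f : C(UnitAddCircle, ℝ)) (x : UnitAddCircle) :
    complexify f x = (f x : ℂ) := rfl

theorem complexify_mul (f g : C(UnitAddCircle, ℝ)) :
    complexify (f * g) = complexify f * complexify g := by
  ext x
  simp [complexify_apply]

theorem complexify_one : complexify 1 = 1 := by
  ext x
  simp [complexify_apply]

theorem complexify_injective : Function.Injective complexify := by
  intro f g h
  ext x
  exact Complex.ofReal_injective (DFunLike.congr_fun h x)

theorem weightedCoeff_eq (r : ℝ) (f : C(UnitAddCircle, ℝ)) :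
    weightedCoeff r f = weightedCoeffC r (complexify f) := rfl

namespace Sobolev

variable {r : ℝ}

/-- The `n`-th Fourier coefficient of a Sobolev function. -/
def coeff (f : Sobolev r) (n : ℤ) : ℂ := fourierCoeff (complexify f.toContinuousMap) n

theorem coeffs_apply (f : Sobolev r) (n : ℤ) :
    coeffs r f n = (weight r n : ℂ) * f.coeff n := rfl

theorem norm_eq (f : Sobolev r) : ‖f‖ = ‖coeffs r f‖ := rfl

theorem norm_coeffs_apply (f : Sobolev r) (n : ℤ) :
    ‖coeffs r f n‖ = weight r n * ‖f.coeff n‖ := by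
  rw [coeffs_apply, norm_mul, Complex.norm_real, Real.norm_of_nonneg (weight_pos r n).le]

theorem toContinuousMap_injective : Function.Injective (toContinuousMap (r := r)) :=
  Subtype.val_injective

theorem ext_coeff {f g : Sobolev r} (h : ∀ n, f.coeff n = g.coeff n) : f = g :=
  toContinuousMap_injective (complexify_injective (continuousMap_ext_fourierCoeff h))

theorem ext_lift {f g : Sobolev r} (h : ∀ x, f.lift x = g.lift x) : f = g := by
  refine toContinuousMap_injective (ContinuousMap.ext fun x => ?_)
  obtain ⟨y, rfl⟩ := QuotientAddGroup.mk_surjective x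
  exact h y

theorem continuous_lift (f : Sobolev r) : Continuous f.lift :=
  f.toContinuousMap.continuous.comp (AddCircle.continuous_mk' 1)

theorem lift_add_one (f : Sobolev r) (x : ℝ) : f.lift (x + 1) = f.lift x := by
  unfold lift
  rw [AddCircle.coe_add_period]

theorem coeff_neg (f : Sobolev r) (n : ℤ) : f.coeff (-n) = starRingEnd ℂ (f.coeff n) := by
  unfold coeff fourierCoeff
  rw [← integral_conj]
  congr 1
  funext x
  rw [smul_eq_mul, smul_eq_mul, map_mul, ← fourier_neg, complexify_apply, Complex.conj_ofReal]

theorem memℓp_coeff (f : Sobolev r) :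
    Memℓp (weightedCoeffC r (complexify f.toContinuousMap)) 2 := f.2

theorem summable_coeff (hr : 1 / 2 < r) (f : Sobolev r) : Summable f.coeff :=
  summable_fourierCoeff hr f.memℓp_coeff

theorem hasSum_coeff (hr : 1 / 2 < r) (f : Sobolev r) (x : ℝ) :
    HasSum (fun n => f.coeff n * fourier n (x : UnitAddCircle)) (f.lift x : ℂ) :=
  has_pointwise_sum_fourier_series_of_summable (f.summable_coeff hr) (x : UnitAddCircle)

/-- Conjugate symmetry of the coefficients says that the sum F and its conjugate have the same
Fourier coefficients, so F is real. -/
theorem exists_of_coeff (hr : 1 / 2 < r) {c : ℤ → ℂ} (hc : ∀ n, c (-n) = starRingEnd ℂ (c n))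
    (hm : Memℓp (fun n => (weight r n : ℂ) * c n) 2) :
    ∃ f : Sobolev r, ∀ n, f.coeff n = c n := by
  have hs : Summable c := by
    refine Summable.of_norm ((summable_norm_div_weight hr hm).congr fun n => ?_)
    have := weight_pos r n
    rw [norm_mul, Complex.norm_real, Real.norm_of_nonneg this.le]
    field_simp
  set F := fourierSeries c
  have hFc : ∀ n, fourierCoeff F n = c n := fourierCoeff_fourierSeries hs
  have hstar : star F = F := by
    refine continuousMap_ext_fourierCoeff fun n => ?_
    have h := hc (-n)
    rw [neg_neg] at h
    rw [hFc, h, ← hFc]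
    unfold fourierCoeff
    rw [← integral_conj]
    congr 1
    funext x
    rw [smul_eq_mul, smul_eq_mul, map_mul, ← fourier_neg, neg_neg]
    rfl
  let f : C(UnitAddCircle, ℝ) := ⟨fun x => (F x).re, Complex.continuous_re.comp F.continuous⟩
  have hf : complexify f = F := by
    ext x
    have h := DFunLike.congr_fun hstar x
    exact Complex.conj_eq_iff_re.1 h
  have hmem : Memℓp (weightedCoeff r f) 2 := by
    have h : weightedCoeff r f = fun n => (weight r n : ℂ) * c n := by
      funext n
      rw [weightedCoeff_eq, hf, weightedCoeffC, hFc]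
    rw [h]
    exact hm
  refine ⟨⟨f, hmem⟩, fun n => ?_⟩
  change fourierCoeff (complexify f) n = c n
  rw [hf, hFc]

theorem norm_le_of_coeff_le {r' C : ℝ} (hC : 0 ≤ C) {f : Sobolev r} {g : Sobolev r'}
    (h : ∀ n, weight r' n * ‖g.coeff n‖ ≤ C * (weight r n * ‖f.coeff n‖)) : ‖g‖ ≤ C * ‖f‖ := by
  rw [norm_eq, norm_eq]
  have hs := memℓp_two_iff_summable_sq.1 (coeffs r f).2
  refine lp_norm_le_of_hasSum (by positivity) (hs.mul_left (C ^ 2)) (fun n => ?_) ?_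
  · rw [← mul_pow]
    have hn : 0 ≤ weight r' n * ‖g.coeff n‖ := by
      have := weight_pos r' n
      positivity
    refine pow_le_pow_left₀ (norm_nonneg _) ?_ 2
    change ‖coeffs r' g n‖ ≤ C * ‖coeffs r f n‖
    rw [norm_coeffs_apply, norm_coeffs_apply]
    exact h n
  · rw [tsum_mul_left, mul_pow, lp_norm_sq_eq_tsum]

/-! ### Fourier multipliers -/

theorem coeff_add (f g : Sobolev r) (n : ℤ) : (f + g).coeff n = f.coeff n + g.coeff n :=
  map_add (fourierCoeffCLM n) (complexify f.toContinuousMap) (complexify g.toContinuousMap) ▸ by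
    change fourierCoeffCLM n _ = fourierCoeffCLM n _
    congr 1
    ext x
    exact Complex.ofReal_add _ _

theorem coeff_smul (c : ℝ) (f : Sobolev r) (n : ℤ) : (c • f).coeff n = c * f.coeff n := by
  have h := map_smul (fourierCoeffCLM n) (c : ℂ) (complexify f.toContinuousMap)
  rw [smul_eq_mul] at h
  refine Eq.trans ?_ h
  change fourierCoeffCLM n _ = fourierCoeffCLM n _
  congr 1
  ext x
  exact Complex.ofReal_mul _ _

/-- Common source of differentiation and integration: `hσ` keeps real functions real, and `hb`
bounds the operator from `H^r` to `H^{r'}`. -/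
theorem exists_multiplier {r' C : ℝ} (hr' : 1 / 2 < r') (hC : 0 ≤ C) {σ : ℤ → ℂ}
    (hσ : ∀ n, σ (-n) = starRingEnd ℂ (σ n))
    (hb : ∀ n, weight r' n * ‖σ n‖ ≤ C * weight r n) :
    ∃ T : Sobolev r →L[ℝ] Sobolev r', ∀ f n, (T f).coeff n = σ n * f.coeff n := by
  have hb' : ∀ (f : Sobolev r) (n : ℤ),
      weight r' n * ‖σ n * f.coeff n‖ ≤ C * (weight r n * ‖f.coeff n‖) := by
    intro f n
    rw [norm_mul, ← mul_assoc, ← mul_assoc]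
    exact mul_le_mul_of_nonneg_right (hb n) (norm_nonneg _)
  have h : ∀ f : Sobolev r, ∃ g : Sobolev r', ∀ n, g.coeff n = σ n * f.coeff n := by
    intro f
    refine exists_of_coeff hr' (fun n => ?_) ?_
    · rw [hσ, coeff_neg, map_mul]
    · rw [memℓp_two_iff_summable_sq]
      refine Summable.of_nonneg_of_le (fun n => by positivity) (fun n => ?_)
        ((memℓp_two_iff_summable_sq.1 (coeffs r f).2).mul_left (C ^ 2))
      rw [← mul_pow]
      refine pow_le_pow_left₀ (norm_nonneg _) ?_ 2
      change _ ≤ C * ‖coeffs r f n‖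
      rw [norm_coeffs_apply, norm_mul, Complex.norm_real,
        Real.norm_of_nonneg (weight_pos r' n).le]
      exact hb' f n
  choose T hT using h
  refine ⟨LinearMap.mkContinuous
    { toFun := T
      map_add' := fun f g => ext_coeff fun n => by
        rw [coeff_add, hT, hT, hT, coeff_add, mul_add]
      map_smul' := fun c f => ext_coeff fun n => by
        rw [RingHom.id_apply, coeff_smul, hT, hT, coeff_smul, mul_left_comm] } C fun f => ?_, hT⟩
  refine norm_le_of_coeff_le hC fun n => ?_
  change weight r' n * ‖(T f).coeff n‖ ≤ _
  rw [hT]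
  exact hb' f n

/-! ### The embedding into the continuous functions -/

/-- The constant in the Sobolev inequality. -/
def supConst (r : ℝ) : ℝ := √(∑' n : ℤ, (weight r n ^ 2)⁻¹)

/-- Cauchy–Schwarz on partial Fourier sums, pairing the inverse weights with the weighted
coefficients. -/
theorem abs_apply_le (hr : 1 / 2 < r) (f : Sobolev r) (x : UnitAddCircle) :
    |f.toContinuousMap x| ≤ supConst r * ‖f‖ := by
  have hS : 0 ≤ ∑' n : ℤ, (weight r n ^ 2)⁻¹ := tsum_nonneg fun n => by positivity
  have hlim := (has_pointwise_sum_fourier_series_of_summable (f.summable_coeff hr) x).norm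
  rw [complexify_apply, Complex.norm_real, Real.norm_eq_abs] at hlim
  refine le_of_tendsto hlim (Filter.Eventually.of_forall fun t => ?_)
  refine le_of_sq_le_sq ?_ (by unfold supConst; positivity)
  have h1 : ‖∑ n ∈ t, f.coeff n • fourier n x‖ ≤
      ∑ n ∈ t, (weight r n)⁻¹ * ‖coeffs r f n‖ := by
    refine (norm_sum_le _ _).trans (Finset.sum_le_sum fun n _ => le_of_eq ?_)
    have := weight_pos r n
    rw [norm_smul, fourier_apply, Circle.norm_coe, norm_coeffs_apply]
    field_simp
  calc ‖∑ n ∈ t, f.coeff n • fourier n x‖ ^ 2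
      ≤ (∑ n ∈ t, (weight r n)⁻¹ * ‖coeffs r f n‖) ^ 2 := by gcongr
    _ ≤ (∑ n ∈ t, (weight r n)⁻¹ ^ 2) * ∑ n ∈ t, ‖coeffs r f n‖ ^ 2 :=
        Finset.sum_mul_sq_le_sq_mul_sq _ _ _
    _ ≤ (supConst r * ‖f‖) ^ 2 := by
        rw [mul_pow, supConst, Real.sq_sqrt hS, norm_eq, lp_norm_sq_eq_tsum]
        refine mul_le_mul ?_ ?_ (Finset.sum_nonneg fun _ _ => by positivity) hS
        · simp only [inv_pow]
          exact (summable_inv_weight_sq hr).sum_le_tsum _ fun n _ => by positivity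
        · exact (memℓp_two_iff_summable_sq.1 (coeffs r f).2).sum_le_tsum _
            fun n _ => by positivity

/-- The embedding of `H^r` into the continuous functions. -/
def toContinuousMapCLM (r : ℝ) (hr : 1 / 2 < r) : Sobolev r →L[ℝ] C(UnitAddCircle, ℝ) :=
  LinearMap.mkContinuous
    { toFun := toContinuousMap
      map_add' := fun _ _ => rfl
      map_smul' := fun _ _ => rfl } (supConst r) fun f =>
    (ContinuousMap.norm_le _ (by unfold supConst; positivity)).2 fun x => abs_apply_le hr f x

/-- Evaluation at a point. -/
def evalCLM (hr : 1 / 2 < r) (x : ℝ) : Sobolev r →L[ℝ] ℝ :=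
  (ContinuousMap.evalCLM ℝ (x : UnitAddCircle)).comp (toContinuousMapCLM r hr)

/-- The mean value of a Sobolev function. -/
def mean (hr : 1 / 2 < r) : Sobolev r →L[ℝ] ℝ :=
  (Complex.reCLM.comp ((fourierCoeffCLM 0).restrictScalars ℝ)).comp
    ((Complex.ofRealCLM.compLeftContinuous ℝ UnitAddCircle).comp (toContinuousMapCLM r hr))

theorem ofReal_mean (hr : 1 / 2 < r) (f : Sobolev r) : (mean hr f : ℂ) = f.coeff 0 := by
  have h : mean hr f = (f.coeff 0).re := rfl
  rw [h]
  refine Complex.conj_eq_iff_re.1 ?_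
  rw [← coeff_neg, neg_zero]

theorem mean_eq_integral (hr : 1 / 2 < r) (f : Sobolev r) :
    mean hr f = ∫ x in (0 : ℝ)..1, f.lift x := by
  refine Complex.ofReal_injective ?_
  rw [ofReal_mean, coeff, fourierCoeff_eq_intervalIntegral _ 0 0]
  simp only [neg_zero, fourier_zero, one_smul, div_one, zero_add, complexify_apply]
  exact intervalIntegral.integral_ofReal

/-! ### Multiplication and reciprocals -/

instance : One (Sobolev r) :=
  ⟨⟨1, by
    change Memℓp (weightedCoeff r 1) 2
    rw [weightedCoeff_eq, complexify_one, ← fourier_zero_eq_one]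
    exact memℓp_weightedCoeffC_fourier r 0⟩⟩

theorem lift_one (x : ℝ) : (1 : Sobolev r).lift x = 1 := rfl

/-- Multiplication of Sobolev functions, as a continuous bilinear map. -/
def mul (hr : 1 / 2 < r) : Sobolev r →L[ℝ] Sobolev r →L[ℝ] Sobolev r :=
  LinearMap.mkContinuous₂
    (LinearMap.mk₂ ℝ
      (fun f g : Sobolev r => (⟨f.toContinuousMap * g.toContinuousMap, by
        change Memℓp (weightedCoeff r _) 2
        rw [weightedCoeff_eq, complexify_mul]
        exact memℓp_weightedCoeffC_mul hr f.memℓp_coeff g.memℓp_coeff⟩ : Sobolev r))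
      (fun f f' g => toContinuousMap_injective (add_mul _ _ _))
      (fun c f g => toContinuousMap_injective (smul_mul_assoc _ _ _))
      (fun f g g' => toContinuousMap_injective (mul_add _ _ _))
      (fun c f g => toContinuousMap_injective (mul_smul_comm _ _ _)))
    (√(convConst r)) fun f g => by
      refine norm_weightedCoeffC_mul_le hr (F := complexify f.toContinuousMap)
        (G := complexify g.toContinuousMap) (fun n => rfl) (fun n => rfl) (fun n => ?_)
      rw [← complexify_mul]
      rfl

theorem lift_mul (hr : 1 / 2 < r) (f g : Sobolev r) (x : ℝ) :
    (mul hr f g).lift x = f.lift x * g.lift x := rfl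

/-- The coefficient map embeds the real space isometrically onto the sequences in ℓ² with b(-n)
equal to the conjugate of b(n), a closed condition. -/
theorem completeSpace (hr : 1 / 2 < r) : CompleteSpace (Sobolev r) := by
  have hiso : Isometry (coeffs r) := AddMonoidHomClass.isometry_of_norm _ fun f => (norm_eq f).symm
  have hrange : Set.range (coeffs r) =
      {b : lp (fun _ : ℤ => ℂ) 2 | ∀ n, b (-n) = starRingEnd ℂ (b n)} := by
    ext b
    constructor
    · rintro ⟨f, rfl⟩ n
      rw [coeffs_apply, coeffs_apply, coeff_neg, weight_neg, map_mul, Complex.conj_ofReal]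
    · intro hb
      have hw : ∀ n, (weight r n : ℂ) ≠ 0 := fun n => Complex.ofReal_ne_zero.2 (weight_pos r n).ne'
      have h1 : (fun n => (weight r n : ℂ) * ((weight r n : ℂ)⁻¹ * b n)) = b := by
        funext n
        exact mul_inv_cancel_left₀ (hw n) _
      obtain ⟨f, hf⟩ := exists_of_coeff hr (c := fun n => (weight r n : ℂ)⁻¹ * b n)
        (fun n => by rw [hb n, weight_neg, map_mul, map_inv₀, Complex.conj_ofReal])
        (by rw [h1]; exact b.2)
      refine ⟨f, ?_⟩
      ext n
      rw [coeffs_apply, hf, mul_inv_cancel_left₀ (hw n)]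
  have hclosed : IsClosed (Set.range (coeffs r)) := by
    rw [hrange, Set.ofPred_forall]
    refine isClosed_iInter fun n => ?_
    have hc : ∀ n : ℤ, Continuous fun b : lp (fun _ : ℤ => ℂ) 2 => b n := fun n =>
      (lp.lipschitzWith_one_eval 2 n).continuous
    exact isClosed_eq (hc (-n)) (Complex.continuous_conj.comp (hc n))
  exact (completeSpace_iff_isComplete_range hiso.isUniformInducing).2 hclosed.isComplete

/-- The inverse in the complex algebra must be the pointwise reciprocal, which is real. -/
theorem exists_reciprocal (hr : 1 / 2 < r) (f : Sobolev r) (hf : ∀ x, f.lift x ≠ 0) :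
    ∃ g : Sobolev r, mul hr f g = 1 := by
  let F : SobolevC r hr := ⟨complexify f.toContinuousMap, f.memℓp_coeff⟩
  have hF : IsUnit F := F.isUnit_of_forall_ne_zero fun x => by
    obtain ⟨y, rfl⟩ := QuotientAddGroup.mk_surjective x
    exact Complex.ofReal_ne_zero.2 (hf y)
  obtain ⟨G, hG⟩ := hF.exists_right_inv
  have hG' : ∀ x, (f.toContinuousMap x : ℂ) * G.val x = 1 := fun x => by
    have h := congrArg (fun K : SobolevC r hr => K.val x) hG
    simp only [map_mul, map_one] at h
    exact h
  have hf' : ∀ x, f.toContinuousMap x ≠ 0 := fun x => by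
    obtain ⟨y, rfl⟩ := QuotientAddGroup.mk_surjective x
    exact hf y
  let g : C(UnitAddCircle, ℝ) := ⟨fun x => (f.toContinuousMap x)⁻¹,
    f.toContinuousMap.continuous.inv₀ hf'⟩
  have hg : complexify g = G.val := by
    ext x
    rw [complexify_apply]
    change (((f.toContinuousMap x)⁻¹ : ℝ) : ℂ) = _
    rw [Complex.ofReal_inv]
    exact (eq_inv_of_mul_eq_one_right (hG' x)).symm
  refine ⟨⟨g, ?_⟩, ?_⟩
  · change Memℓp (weightedCoeff r g) 2
    rw [weightedCoeff_eq, hg]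
    exact G.memℓp
  · refine ext_lift fun x => ?_
    exact mul_inv_cancel₀ (hf x)

/-- The reciprocal of a nowhere vanishing Sobolev function. -/
def reciprocal (hr : 1 / 2 < r) (f : Sobolev r) : Sobolev r := (mul hr f).inverse 1

theorem exists_mul_equiv (hr : 1 / 2 < r) (f : Sobolev r) (hf : ∀ x, f.lift x ≠ 0) :
    ∃ e : Sobolev r ≃L[ℝ] Sobolev r, (e : Sobolev r →L[ℝ] Sobolev r) = mul hr f := by
  obtain ⟨g, hg⟩ := exists_reciprocal hr f hf
  have hfg : ∀ x, f.lift x * g.lift x = 1 := fun x => by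
    rw [← lift_mul hr, hg, lift_one]
  refine ⟨ContinuousLinearEquiv.equivOfInverse (mul hr f) (mul hr g) (fun k => ?_) fun k => ?_, rfl⟩
  · refine ext_lift fun x => ?_
    rw [lift_mul, lift_mul, ← mul_assoc, mul_comm (g.lift x), hfg, one_mul]
  · refine ext_lift fun x => ?_
    rw [lift_mul, lift_mul, ← mul_assoc, hfg, one_mul]

theorem lift_reciprocal (hr : 1 / 2 < r) (f : Sobolev r) (hf : ∀ x, f.lift x ≠ 0) (x : ℝ) :
    (reciprocal hr f).lift x = (f.lift x)⁻¹ := by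
  obtain ⟨e, he⟩ := exists_mul_equiv hr f hf
  have h : mul hr f (reciprocal hr f) = 1 := by
    rw [reciprocal, ← he, ContinuousLinearMap.inverse_equiv]
    exact e.apply_symm_apply 1
  refine eq_inv_of_mul_eq_one_right ?_
  rw [← lift_mul hr, h, lift_one]

/-- Writing 1/f as the inverse of the operator "multiply by f", applied to 1, reduces smoothness to
that of operator inversion on a Banach space. -/
theorem contDiffAt_reciprocal (hr : 1 / 2 < r) (f : Sobolev r) (hf : ∀ x, f.lift x ≠ 0) :
    ContDiffAt ℝ ∞ (reciprocal hr) f := by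
  obtain ⟨e, he⟩ := exists_mul_equiv hr f hf
  have := completeSpace hr
  have h := contDiffAt_map_inverse (𝕜 := ℝ) (n := ∞) e
  rw [he] at h
  exact (h.comp f (mul hr).contDiff.contDiffAt).clm_apply contDiffAt_const

/-! ### Differentiation and integration -/

theorem weight_sub_one (r : ℝ) (n : ℤ) :
    weight (r - 1) n * (1 + (n : ℝ) ^ 2) ^ ((1 : ℝ) / 2) = weight r n := by
  rw [weight, weight, ← Real.rpow_add (by positivity)]
  congr 1
  ring

theorem exists_derivCLM (hr : 1 / 2 < r - 1) :
    ∃ T : Sobolev r →L[ℝ] Sobolev (r - 1), ∀ f n,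
      (T f).coeff n = 2 * Real.pi * Complex.I * n * f.coeff n := by
  refine exists_multiplier hr (C := 2 * Real.pi) (by positivity) (fun n => ?_) fun n => ?_
  · simp only [Int.cast_neg, map_mul, Complex.conj_ofReal, Complex.conj_I, map_intCast,
      map_ofNat]
    ring
  · have h0 := weight_pos (r - 1) n
    have h1 : |(n : ℝ)| ≤ (1 + (n : ℝ) ^ 2) ^ ((1 : ℝ) / 2) := by
      rw [← Real.sqrt_eq_rpow]
      exact Real.abs_le_sqrt (by linarith)
    have h2 : ‖(2 * Real.pi * Complex.I * n : ℂ)‖ = 2 * Real.pi * |(n : ℝ)| := by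
      simp [abs_of_pos Real.pi_pos]
    rw [h2, ← weight_sub_one r]
    calc weight (r - 1) n * (2 * Real.pi * |(n : ℝ)|)
        = 2 * Real.pi * (weight (r - 1) n * |(n : ℝ)|) := by ring
      _ ≤ _ := by gcongr

/-- Differentiation `H^r → H^{r-1}`. -/
def derivCLM (hr : 1 / 2 < r - 1) : Sobolev r →L[ℝ] Sobolev (r - 1) := (exists_derivCLM hr).choose

theorem coeff_derivCLM (hr : 1 / 2 < r - 1) (f : Sobolev r) (n : ℤ) :
    (derivCLM hr f).coeff n = 2 * Real.pi * Complex.I * n * f.coeff n :=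
  (exists_derivCLM hr).choose_spec f n

/-- Termwise differentiation of the Fourier series: r - 1 > 1/2 makes the coefficients of the
derivative absolutely summable. -/
theorem hasDerivAt_lift (hr : 1 / 2 < r - 1) (f : Sobolev r) (x : ℝ) :
    HasDerivAt f.lift ((derivCLM hr f).lift x) x := by
  have hr1 : 1 / 2 < r := by linarith
  have h := hasDerivAt_tsum (𝕜 := ℝ) (F := ℂ) (u := fun n => ‖(derivCLM hr f).coeff n‖)
    (g := fun n y => f.coeff n * fourier n (y : UnitAddCircle))
    (g' := fun n y => (derivCLM hr f).coeff n * fourier n (y : UnitAddCircle)) (y₀ := 0)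
    ((derivCLM hr f).summable_coeff hr).norm (fun n y => ?_) (fun n y => ?_)
    (f.hasSum_coeff hr1 0).summable x
  · have h1 : (fun z : ℝ => ∑' n, f.coeff n * fourier n (z : UnitAddCircle))
        = fun z => (f.lift z : ℂ) := by
      funext z
      exact (f.hasSum_coeff hr1 z).tsum_eq
    rw [h1, ((derivCLM hr f).hasSum_coeff hr x).tsum_eq] at h
    exact Complex.reCLM.hasFDerivAt.comp_hasDerivAt x h
  · have h2 := (hasDerivAt_fourier 1 n y).const_mul (f.coeff n)
    refine h2.congr_deriv ?_
    rw [coeff_derivCLM, Complex.ofReal_one, div_one]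
    ring
  · rw [norm_mul, fourier_apply, Circle.norm_coe, mul_one]

theorem exists_primitive (hr : 1 / 2 < r) :
    ∃ T : Sobolev (r - 1) →L[ℝ] Sobolev r, ∀ f n,
      (T f).coeff n = (2 * Real.pi * Complex.I * n)⁻¹ * f.coeff n := by
  refine exists_multiplier hr (C := 1) (by positivity) (fun n => ?_) fun n => ?_
  · simp only [Int.cast_neg, map_mul, map_inv₀, Complex.conj_ofReal, Complex.conj_I, map_intCast,
      map_ofNat]
    ring
  · have h0 := weight_pos (r - 1) n
    -- At n = 0 the multiplier is 0⁻¹ = 0, so the primitive has mean zero and the mean of f is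
    -- discarded.
    rcases eq_or_ne n 0 with rfl | hn
    · simp [weight]
    have hn' : 1 ≤ |(n : ℝ)| := by exact_mod_cast Int.one_le_abs hn
    have h1 : (1 + (n : ℝ) ^ 2) ^ ((1 : ℝ) / 2) ≤ 2 * Real.pi * |(n : ℝ)| := by
      rw [← Real.sqrt_eq_rpow]
      refine Real.sqrt_le_iff.2 ⟨by positivity, ?_⟩
      have h3 := Real.pi_gt_three
      have h5 : 2 * |(n : ℝ)| ≤ 2 * Real.pi * |(n : ℝ)| := by nlinarith
      have h4 : (2 * |(n : ℝ)|) ^ 2 ≤ (2 * Real.pi * |(n : ℝ)|) ^ 2 := by gcongr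
      have h6 : 1 ≤ |(n : ℝ)| ^ 2 := by nlinarith
      rw [mul_pow, sq_abs] at h4
      rw [sq_abs] at h6
      linarith
    have h2 : ‖(2 * Real.pi * Complex.I * n : ℂ)⁻¹‖ = (2 * Real.pi * |(n : ℝ)|)⁻¹ := by
      rw [norm_inv]
      simp [abs_of_pos Real.pi_pos]
    rw [h2, one_mul, ← weight_sub_one r, mul_inv_le_iff₀ (by positivity)]
    gcongr

/-- The primitive of mean zero of `f` minus its mean value. -/
def primitive (hr : 1 / 2 < r) : Sobolev (r - 1) →L[ℝ] Sobolev r := (exists_primitive hr).choose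

theorem coeff_primitive (hr : 1 / 2 < r) (f : Sobolev (r - 1)) (n : ℤ) :
    (primitive hr f).coeff n = (2 * Real.pi * Complex.I * n)⁻¹ * f.coeff n :=
  (exists_primitive hr).choose_spec f n

theorem coeff_one (n : ℤ) : (1 : Sobolev r).coeff n = if n = 0 then 1 else 0 := by
  change fourierCoeff (complexify 1) n = _
  rw [complexify_one, ← fourier_zero_eq_one, fourierCoeff_fourier, Pi.single_apply]

theorem derivCLM_one (hr : 1 / 2 < r - 1) : derivCLM hr 1 = 0 := by
  refine ext_lift fun x => ?_
  exact (hasDerivAt_lift hr 1 x).unique (hasDerivAt_const x 1)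

theorem derivCLM_primitive (hr : 1 / 2 < r - 1) (hr' : 1 / 2 < r) (f : Sobolev (r - 1)) :
    derivCLM hr (primitive hr' f) = f - mean hr f • 1 := by
  refine ext_coeff fun n => ?_
  have h : f - mean hr f • 1 = f + (-mean hr f) • 1 := by
    rw [neg_smul]
    exact sub_eq_add_neg _ _
  rw [coeff_derivCLM, coeff_primitive, h, coeff_add, coeff_smul, coeff_one]
  rcases eq_or_ne n 0 with rfl | hn
  · simp [ofReal_mean]
  · have h1 : (2 * Real.pi * Complex.I * n : ℂ) ≠ 0 := by
      simp [hn, Real.pi_ne_zero]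
    rw [mul_inv_cancel_left₀ h1, if_neg hn, mul_zero, add_zero]

theorem mean_derivCLM (hr : 1 / 2 < r - 1) (f : Sobolev r) : mean hr (derivCLM hr f) = 0 := by
  refine Complex.ofReal_injective ?_
  rw [ofReal_mean, coeff_derivCLM]
  simp

end Sobolev

/-- Differentiation `H₀^s → H^{s-1}`. -/
def deriv₀ {s : ℝ} (hs : 1 / 2 < s - 1) : Sobolev₀ s →L[ℝ] Sobolev (s - 1) :=
  (Sobolev.derivCLM hs).comp (Sobolev₀ s).subtypeL

theorem hasDerivAt_lift₀ {s : ℝ} (hs : 1 / 2 < s - 1) (f : Sobolev₀ s) (x : ℝ) :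
    HasDerivAt (f : Sobolev s).lift ((deriv₀ hs f).lift x) x :=
  Sobolev.hasDerivAt_lift hs f x

theorem deriv₀_injective {s : ℝ} (hs : 1 / 2 < s - 1) : Function.Injective (deriv₀ hs) := by
  intro f g h
  refine Subtype.ext (Sobolev.ext_lift fun x => ?_)
  have hd : ∀ y, HasDerivAt (fun y => (f : Sobolev s).lift y - (g : Sobolev s).lift y) 0 y := by
    intro y
    have h1 := (hasDerivAt_lift₀ hs f y).sub (hasDerivAt_lift₀ hs g y)
    rw [h, sub_self] at h1
    exact h1
  have h2 := is_const_of_deriv_eq_zero (fun y => (hd y).differentiableAt)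
    (fun y => (hd y).deriv) x 0
  have hf : (f : Sobolev s).lift 0 = 0 := f.2
  have hg : (g : Sobolev s).lift 0 = 0 := g.2
  rw [hf, hg] at h2
  linarith

theorem mean_deriv₀ {s : ℝ} (hs : 1 / 2 < s - 1) (f : Sobolev₀ s) :
    Sobolev.mean hs (deriv₀ hs f) = 0 :=
  Sobolev.mean_derivCLM hs f

/-- The primitive in `H₀^s` of `f ∈ H^{s-1}` minus its mean value. -/
def primitive₀ {s : ℝ} (hs : 1 / 2 < s) : Sobolev (s - 1) →L[ℝ] Sobolev₀ s :=
  (Sobolev.primitive hs -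
    ((Sobolev.evalCLM hs 0).comp (Sobolev.primitive hs)).smulRight (1 : Sobolev s)).codRestrict
    (Sobolev₀ s) fun f => by
      change (Sobolev.primitive hs f).lift 0 - (Sobolev.primitive hs f).lift 0 * 1 = 0
      rw [mul_one, sub_self]

theorem deriv₀_primitive₀ {s : ℝ} (hs : 1 / 2 < s - 1) (hs' : 1 / 2 < s) (f : Sobolev (s - 1)) :
    deriv₀ hs (primitive₀ hs' f) = f - Sobolev.mean hs f • 1 := by
  change Sobolev.derivCLM hs (Sobolev.primitive hs' f -
    (Sobolev.primitive hs' f).lift 0 • (1 : Sobolev s)) = _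
  rw [map_sub, map_smul, Sobolev.derivCLM_one, smul_zero, sub_zero,
    Sobolev.derivCLM_primitive]

/-! ### Bilinear maps -/

section Bilinear

variable {E F F' A : Type*} [NormedAddCommGroup E] [NormedSpace ℝ E] [NormedAddCommGroup F]
  [NormedSpace ℝ F] [NormedAddCommGroup F'] [NormedSpace ℝ F'] [NormedAddCommGroup A]
  [NormedSpace ℝ A]

variable (E F F') in
/-- Composition of a bilinear map with a linear map on the left, linear in both. -/
def postComp : (F →L[ℝ] F') →L[ℝ] (E →L[ℝ] E →L[ℝ] F) →L[ℝ] (E →L[ℝ] E →L[ℝ] F') :=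
  (ContinuousLinearMap.compL ℝ E (E →L[ℝ] F) (E →L[ℝ] F')).comp
    (ContinuousLinearMap.compL ℝ E F F')

/-- The product, with respect to `mul`, of a vector with a bilinear map. -/
def timesBil (mul : A →L[ℝ] A →L[ℝ] A) (B : E →L[ℝ] E →L[ℝ] A) :
    A →L[ℝ] (E →L[ℝ] E →L[ℝ] A) :=
  (ContinuousLinearMap.precomp (E →L[ℝ] A) B).comp ((ContinuousLinearMap.compL ℝ E A A).comp mul)

theorem contDiffOn_postComp {M : Set E} {Q : E → E →L[ℝ] E →L[ℝ] F} (hQ : ContDiffOn ℝ ∞ Q M)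
    (L : F →L[ℝ] F') : ContDiffOn ℝ ∞ (fun p => postComp E F F' L (Q p)) M :=
  contDiffOn_const.clm_apply hQ

theorem contDiffOn_timesBil {M : Set E} {f : E → A} (hf : ContDiffOn ℝ ∞ f M)
    (mul : A →L[ℝ] A →L[ℝ] A) (B : E →L[ℝ] E →L[ℝ] A) :
    ContDiffOn ℝ ∞ (fun p => timesBil mul B (f p)) M :=
  contDiffOn_const.clm_apply hf

/-- Reduces derivatives of operator-valued maps, such as the Christoffel map, to those of
vector-valued ones. -/
theorem hasFDerivAt_bilinear_apply {Q : E → E →L[ℝ] E →L[ℝ] F}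
    {Q' : E →L[ℝ] E →L[ℝ] E →L[ℝ] F} {p : E} (hQ : HasFDerivAt Q Q' p) (v w : E) :
    HasFDerivAt (fun q => Q q v w) ((Q'.flip v).flip w) p := by
  have h1 : HasFDerivAt (fun q => Q q v) (Q'.flip v) p := by
    simpa using hQ.clm_apply (hasFDerivAt_const v p)
  simpa using h1.clm_apply (hasFDerivAt_const w p)

end Bilinear

/-! ### Calculus on the circle -/

/-- The operations on functions on the circle that enter the Levi-Civita connection: `A` is a space
of functions on the circle that is closed under products and reciprocals, and `H` is the space of
their primitives vanishing at `0`. -/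
structure CircleCalculus (H A : Type*) [NormedAddCommGroup H] [NormedSpace ℝ H]
    [NormedAddCommGroup A] [NormedSpace ℝ A] where
  /-- differentiation -/
  D : H →L[ℝ] A
  /-- the primitive of a function minus its mean -/
  J : A →L[ℝ] H
  /-- multiplication -/
  mul : A →L[ℝ] A →L[ℝ] A
  /-- the constant function `1` -/
  one : A
  /-- the mean value -/
  mean : A →L[ℝ] ℝ
  /-- evaluation at a point -/
  ev : ℝ → A →L[ℝ] ℝ
  /-- the reciprocal -/
  recip : A → A
  ext_ev : ∀ f g, (∀ x, ev x f = ev x g) → f = g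
  ev_mul : ∀ f g x, ev x (mul f g) = ev x f * ev x g
  ev_one : ∀ x, ev x one = 1
  ev_recip : ∀ f, (∀ x, ev x f ≠ 0) → ∀ x, ev x (recip f) = (ev x f)⁻¹
  contDiffAt_recip : ∀ f, (∀ x, ev x f ≠ 0) → ContDiffAt ℝ ∞ recip f
  D_injective : Function.Injective D
  D_J : ∀ f, D (J f) = f - mean f • one
  mean_D : ∀ h, mean (D h) = 0
  eq_zero_of_mean : ∀ f, (∀ x, 0 ≤ ev x f) → mean f = 0 → f = 0
  isOpen_pos : IsOpen {f | ∀ x, 0 < ev x f}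

namespace CircleCalculus

variable {H A : Type*} [NormedAddCommGroup H] [NormedSpace ℝ H] [NormedAddCommGroup A]
  [NormedSpace ℝ A] (C : CircleCalculus H A)

/-- The derivative `φₓ = 1 + hₓ`. -/
def dphi (p : H × A) : A := C.one + C.D p.1

/-- The points with `φₓ > 0`. -/
def domain : Set (H × A) := {p | ∀ x, 0 < C.ev x (C.dphi p)}

/-- `(u, v) ↦ u₁ₓ v₁ₓ`. -/
def bilDD : H × A →L[ℝ] H × A →L[ℝ] A :=
  C.mul.bilinearComp (C.D.comp (ContinuousLinearMap.fst ℝ H A))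
    (C.D.comp (ContinuousLinearMap.fst ℝ H A))

/-- `(u, v) ↦ u₂ v₂`. -/
def bilSS : H × A →L[ℝ] H × A →L[ℝ] A :=
  C.mul.bilinearComp (ContinuousLinearMap.snd ℝ H A) (ContinuousLinearMap.snd ℝ H A)

/-- `(u, v) ↦ u₁ₓ v₂`. -/
def bilDS : H × A →L[ℝ] H × A →L[ℝ] A :=
  C.mul.bilinearComp (C.D.comp (ContinuousLinearMap.fst ℝ H A)) (ContinuousLinearMap.snd ℝ H A)

/-- `1 / φₓ`. -/
def invDphi (p : H × A) : A := C.recip (C.dphi p)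

/-- `(u, v) ↦ u₂ v₂ φₓ - u₁ₓ v₁ₓ / φₓ`, which is `-4` times the density of the metric. -/
def density (p : H × A) : H × A →L[ℝ] H × A →L[ℝ] A :=
  timesBil C.mul C.bilSS (C.dphi p) - timesBil C.mul C.bilDD (C.invDphi p)

/-- The metric as a bilinear form. -/
def metricForm (p : H × A) : H × A →L[ℝ] H × A →L[ℝ] ℝ :=
  postComp (H × A) A ℝ (-(1 / 4 : ℝ) • C.mean) (C.density p)

/-- The Christoffel map of the Levi-Civita connection. -/
def christoffel (p : H × A) : H × A →L[ℝ] H × A →L[ℝ] H × A :=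
  postComp (H × A) A (H × A) ((ContinuousLinearMap.inl ℝ H A).comp ((1 / 2 : ℝ) • C.J))
      (C.density p)
    + postComp (H × A) ℝ (H × A) ((ContinuousLinearMap.inl ℝ H A).comp
      ((ContinuousLinearMap.lsmul ℝ ℝ).flip p.1))
      (postComp (H × A) A ℝ (-(1 / 2 : ℝ) • C.mean) (C.density p))
    + postComp (H × A) A (H × A) (ContinuousLinearMap.inr ℝ H A)
      (timesBil C.mul ((1 / 2 : ℝ) • (C.bilDS + C.bilDS.flip)) (C.invDphi p))

variable {C} {p : H × A}

/-! ### Pointwise formulas for the metric density and the connection. -/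

theorem ev_dphi_ne_zero (hp : p ∈ C.domain) (x : ℝ) : C.ev x (C.dphi p) ≠ 0 := (hp x).ne'

theorem ev_invDphi (hp : p ∈ C.domain) (x : ℝ) :
    C.ev x (C.invDphi p) = (C.ev x (C.dphi p))⁻¹ :=
  C.ev_recip _ (ev_dphi_ne_zero hp) x

theorem density_apply (u v : H × A) :
    C.density p u v = C.mul (C.dphi p) (C.mul u.2 v.2)
      - C.mul (C.invDphi p) (C.mul (C.D u.1) (C.D v.1)) := rfl

theorem ev_density (hp : p ∈ C.domain) (u v : H × A) (x : ℝ) :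
    C.ev x (C.density p u v) = C.ev x (C.dphi p) * (C.ev x u.2 * C.ev x v.2)
      - (C.ev x (C.dphi p))⁻¹ * (C.ev x (C.D u.1) * C.ev x (C.D v.1)) := by
  rw [← ev_invDphi hp, density_apply, map_sub, C.ev_mul, C.ev_mul, C.ev_mul, C.ev_mul]

theorem metricForm_apply (u v : H × A) :
    C.metricForm p u v = -(1 / 4) * C.mean (C.density p u v) := rfl

theorem christoffel_apply (u v : H × A) :
    C.christoffel p u v =
      ((1 / 2 : ℝ) • C.J (C.density p u v) + (-(1 / 2) * C.mean (C.density p u v)) • p.1,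
      C.mul (C.invDphi p) ((1 / 2 : ℝ) • (C.mul (C.D u.1) v.2 + C.mul (C.D v.1) u.2))) := by
  refine Prod.ext ?_ ?_
  · change _ + _ + 0 = _
    rw [add_zero]
    rfl
  · change 0 + 0 + _ = _
    rw [add_zero, zero_add]
    rfl

/-- `J` removes the mean of the density. The multiple of h = `p.1` in `christoffel` supplies the hₓ
part, so that together with this mean the correction is a multiple of φₓ = 1 + hₓ, the radial
direction. -/
theorem ev_D_christoffel (u v : H × A) (x : ℝ) :
    C.ev x (C.D (C.christoffel p u v).1) = 1 / 2 * C.ev x (C.density p u v)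
      - 1 / 2 * C.mean (C.density p u v) * C.ev x (C.dphi p) := by
  rw [christoffel_apply]
  simp only [map_add, map_smul, C.D_J, map_sub, C.ev_one, dphi, smul_eq_mul]
  ring

theorem ev_christoffel_snd (hp : p ∈ C.domain) (u v : H × A) (x : ℝ) :
    C.ev x (C.christoffel p u v).2 = (C.ev x (C.dphi p))⁻¹ * (1 / 2 *
      (C.ev x (C.D u.1) * C.ev x v.2 + C.ev x (C.D v.1) * C.ev x u.2)) := by
  rw [christoffel_apply, ← ev_invDphi hp]
  simp only [map_add, map_smul, C.ev_mul, smul_eq_mul]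
  ring

theorem density_comm (hp : p ∈ C.domain) (u v : H × A) : C.density p u v = C.density p v u := by
  refine C.ext_ev _ _ fun x => ?_
  rw [ev_density hp, ev_density hp]
  ring

theorem christoffel_comm (hp : p ∈ C.domain) (u v : H × A) :
    C.christoffel p u v = C.christoffel p v u := by
  rw [christoffel_apply, christoffel_apply, density_comm hp, add_comm (C.mul (C.D u.1) v.2)]

/-! ### Smoothness -/

theorem contDiff_dphi : ContDiff ℝ ∞ C.dphi :=
  contDiff_const.add (C.D.contDiff.comp contDiff_fst)

theorem isOpen_domain : IsOpen C.domain :=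
  C.isOpen_pos.preimage contDiff_dphi.continuous

theorem contDiffOn_invDphi : ContDiffOn ℝ ∞ C.invDphi C.domain := fun p hp =>
  ((C.contDiffAt_recip _ (ev_dphi_ne_zero hp)).comp p
    contDiff_dphi.contDiffAt).contDiffWithinAt

/-- The density depends on p only through φₓ and 1/φₓ, and linearly on these, so it is smooth in
operator norm and not just pointwise. -/
theorem contDiffOn_density : ContDiffOn ℝ ∞ C.density C.domain :=
  (contDiffOn_timesBil contDiff_dphi.contDiffOn C.mul C.bilSS).sub
    (contDiffOn_timesBil contDiffOn_invDphi C.mul C.bilDD)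

theorem contDiffOn_metricForm : ContDiffOn ℝ ∞ C.metricForm C.domain :=
  contDiffOn_postComp contDiffOn_density _

theorem contDiffOn_christoffel : ContDiffOn ℝ ∞ C.christoffel C.domain := by
  refine ((contDiffOn_postComp contDiffOn_density _).add ?_).add
    (contDiffOn_postComp (contDiffOn_timesBil contDiffOn_invDphi C.mul _) _)
  refine ContDiffOn.clm_apply (ContDiff.contDiffOn ?_) (contDiffOn_postComp contDiffOn_density _)
  refine contDiff_const.clm_apply (ContDiff.clm_comp contDiff_const ?_)
  exact contDiff_const.clm_apply contDiff_fst

/-! ### Derivatives -/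

theorem differentiableAt_invDphi (hp : p ∈ C.domain) : DifferentiableAt ℝ C.invDphi p :=
  (contDiffOn_invDphi.contDiffAt (isOpen_domain.mem_nhds hp)).differentiableAt (by simp)

theorem hasFDerivAt_dphi :
    HasFDerivAt C.dphi (C.D.comp (ContinuousLinearMap.fst ℝ H A)) p :=
  (C.D.comp (ContinuousLinearMap.fst ℝ H A)).hasFDerivAt.const_add C.one

/-- Differentiability is known in the function space, so the value of the derivative can be read off
after evaluation at x, where it is the derivative of a scalar reciprocal. -/
theorem ev_fderiv_invDphi (hp : p ∈ C.domain) (u : H × A) (x : ℝ) :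
    C.ev x (fderiv ℝ C.invDphi p u) =
      -C.ev x (C.D u.1) * ((C.ev x (C.dphi p))⁻¹) ^ 2 := by
  have h1 := (C.ev x).hasFDerivAt.comp p (differentiableAt_invDphi hp).hasFDerivAt
  have h2 := (C.ev x).hasFDerivAt.comp p (hasFDerivAt_dphi (C := C) (p := p))
  have h3 := (hasDerivAt_inv (ev_dphi_ne_zero hp x)).comp_hasFDerivAt p h2
  have h4 := h1.congr_of_eventuallyEq (f₁ := fun q => (C.ev x (C.dphi q))⁻¹) <| by
    filter_upwards [isOpen_domain.mem_nhds hp] with q hq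
    exact (ev_invDphi hq x).symm
  have h5 := DFunLike.congr_fun (h4.unique h3) u
  refine Eq.trans h5 ?_
  change -(C.ev x (C.dphi p) ^ 2)⁻¹ * C.ev x (C.D u.1) = _
  rw [inv_pow]
  ring

variable (C p) in
/-- The derivative of `q ↦ density q v w` at `p`. -/
def densityDeriv (v w : H × A) : H × A →L[ℝ] A :=
  (C.mul.flip (C.mul v.2 w.2)).comp (C.D.comp (ContinuousLinearMap.fst ℝ H A))
    - (C.mul.flip (C.mul (C.D v.1) (C.D w.1))).comp (fderiv ℝ C.invDphi p)

theorem hasFDerivAt_density (hp : p ∈ C.domain) (v w : H × A) :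
    HasFDerivAt (fun q => C.density q v w) (C.densityDeriv p v w) p :=
  (((C.mul.flip (C.mul v.2 w.2)).hasFDerivAt.comp p hasFDerivAt_dphi).sub
    ((C.mul.flip (C.mul (C.D v.1) (C.D w.1))).hasFDerivAt.comp p
      (differentiableAt_invDphi hp).hasFDerivAt))

theorem densityDeriv_apply (u v w : H × A) :
    C.densityDeriv p v w u = C.mul (C.D u.1) (C.mul v.2 w.2)
      - C.mul (fderiv ℝ C.invDphi p u) (C.mul (C.D v.1) (C.D w.1)) := rfl

theorem ev_densityDeriv (hp : p ∈ C.domain) (u v w : H × A) (x : ℝ) :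
    C.ev x (C.densityDeriv p v w u) =
      C.ev x (C.D u.1) * (C.ev x v.2 * C.ev x w.2)
      + C.ev x (C.D u.1) * ((C.ev x (C.dphi p))⁻¹) ^ 2 *
        (C.ev x (C.D v.1) * C.ev x (C.D w.1)) := by
  rw [densityDeriv_apply, map_sub, C.ev_mul, C.ev_mul, C.ev_mul, C.ev_mul, ev_fderiv_invDphi hp]
  ring

/-- Compatibility holds before integration, up to the radial corrections. These correct the first
component by a multiple of φₓ, which cancels the 1/φₓ in the density and leaves multiples of w₁ₓ and
v₁ₓ. -/
theorem density_compatible (hp : p ∈ C.domain) (u v w : H × A) :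
    C.density p (C.christoffel p u v) w + C.density p v (C.christoffel p u w) =
      C.densityDeriv p v w u + (1 / 2 * C.mean (C.density p u v)) • C.D w.1
        + (1 / 2 * C.mean (C.density p u w)) • C.D v.1 := by
  refine C.ext_ev _ _ fun x => ?_
  have hx := ev_dphi_ne_zero hp x
  simp only [map_add, map_smul, smul_eq_mul, ev_densityDeriv hp, ev_density hp,
    ev_D_christoffel, ev_christoffel_snd hp]
  field_simp
  ring

theorem mean_densityDeriv (hp : p ∈ C.domain) (u v w : H × A) :
    C.mean (C.densityDeriv p v w u) =
      C.mean (C.density p (C.christoffel p u v) w)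
        + C.mean (C.density p v (C.christoffel p u w)) := by
  have h := congrArg C.mean (density_compatible hp u v w)
  simp only [map_add, map_smul, C.mean_D, smul_zero, add_zero] at h
  exact h.symm

theorem fderiv_christoffel_apply (hp : p ∈ C.domain) (u v w : H × A) :
    fderiv ℝ C.christoffel p u v w =
      ((1 / 2 : ℝ) • C.J (C.densityDeriv p v w u)
        + ((-(1 / 2) * C.mean (C.density p v w)) • u.1
          + (-(1 / 2) * C.mean (C.densityDeriv p v w u)) • p.1),
      C.mul (fderiv ℝ C.invDphi p u)
        ((1 / 2 : ℝ) • (C.mul (C.D v.1) w.2 + C.mul (C.D w.1) v.2))) := by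
  have hd : DifferentiableAt ℝ C.christoffel p :=
    (contDiffOn_christoffel.contDiffAt (isOpen_domain.mem_nhds hp)).differentiableAt (by simp)
  have h1 := hasFDerivAt_bilinear_apply hd.hasFDerivAt v w
  have hden := hasFDerivAt_density hp v w
  have hmean := (-(1 / 2 : ℝ) • C.mean).hasFDerivAt.comp p hden
  have hfst := ((((1 / 2 : ℝ) • C.J).hasFDerivAt.comp p hden).add
    (hmean.smul (hasFDerivAt_fst (𝕜 := ℝ) (E := H) (F := A))))
  have hsnd := (C.mul.flip
    ((1 / 2 : ℝ) • (C.mul (C.D v.1) w.2 + C.mul (C.D w.1) v.2))).hasFDerivAt.comp p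
      (differentiableAt_invDphi hp).hasFDerivAt
  have h3 := (hfst.prodMk hsnd).congr_of_eventuallyEq (f₁ := fun q => C.christoffel q v w)
    (Filter.Eventually.of_forall fun q => christoffel_apply v w)
  exact DFunLike.congr_fun (h1.unique h3) u

theorem ev_D_fderiv_christoffel (hp : p ∈ C.domain) (u v w : H × A) (x : ℝ) :
    C.ev x (C.D (fderiv ℝ C.christoffel p u v w).1) =
      1 / 2 * C.ev x (C.densityDeriv p v w u)
        - 1 / 2 * C.mean (C.density p v w) * C.ev x (C.D u.1)
        - 1 / 2 * C.mean (C.densityDeriv p v w u) * C.ev x (C.dphi p) := by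
  rw [fderiv_christoffel_apply hp]
  simp only [map_add, map_smul, C.D_J, map_sub, C.ev_one, dphi, smul_eq_mul]
  ring

theorem ev_fderiv_christoffel_snd (hp : p ∈ C.domain) (u v w : H × A) (x : ℝ) :
    C.ev x (fderiv ℝ C.christoffel p u v w).2 =
      -C.ev x (C.D u.1) * ((C.ev x (C.dphi p))⁻¹) ^ 2 * (1 / 2 *
        (C.ev x (C.D v.1) * C.ev x w.2 + C.ev x (C.D w.1) * C.ev x v.2)) := by
  rw [fderiv_christoffel_apply hp, ← ev_fderiv_invDphi hp]
  simp only [map_add, map_smul, C.ev_mul, smul_eq_mul]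
  ring

/-- The form of the curvature tensor on a space of constant curvature 1. Since `D` is injective,
both components can be compared at each point of the circle, where only the means remain nonlocal.
-/
theorem curvature_christoffel (hp : p ∈ C.domain) (u v w : H × A) :
    curvature C.christoffel p u v w =
      C.metricForm p v w • u - C.metricForm p u w • v := by
  rw [metricForm_apply, metricForm_apply]
  refine Prod.ext (C.D_injective (C.ext_ev _ _ fun x => ?_)) (C.ext_ev _ _ fun x => ?_)
  · have hx := ev_dphi_ne_zero hp x
    have h1 := mean_densityDeriv hp u v w
    have h2 := mean_densityDeriv hp v u w
    -- With `h1` and `h2`, the means containing a Christoffel term cancel under antisymmetrization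
    -- in u and v; this needs the same Γ(u, v) in both.
    rw [christoffel_comm hp v u] at h2
    simp only [curvature, Prod.fst_sub, Prod.fst_add, Prod.smul_fst, map_sub, map_add, map_smul,
      smul_eq_mul, ev_D_fderiv_christoffel hp, ev_D_christoffel, h1, h2]
    simp only [ev_densityDeriv hp, ev_density hp, ev_D_christoffel, ev_christoffel_snd hp]
    field_simp
    ring
  · have hx := ev_dphi_ne_zero hp x
    simp only [curvature, Prod.snd_sub, Prod.snd_add, Prod.smul_snd, map_sub, map_add, map_smul,
      smul_eq_mul, ev_fderiv_christoffel_snd hp, ev_christoffel_snd hp, ev_D_christoffel,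
      ev_density hp]
    field_simp
    ring

/-! ### Metrics that are given by `metricForm` -/

variable {g : H × A → H × A → H × A → ℝ}

theorem isWeakPseudoRiemannian (hg : ∀ p ∈ C.domain, ∀ u v, g p u v = C.metricForm p u v) :
    IsWeakPseudoRiemannian C.domain g where
  smooth := ⟨C.metricForm, contDiffOn_metricForm, fun p hp u v => (hg p hp u v).symm⟩
  symm p hp u v := by
    rw [hg p hp, hg p hp, metricForm_apply, metricForm_apply, density_comm hp]
  nondegenerate p hp u hu := by
    -- Flipping the sign of the second component undoes the indefinite signature: the integrand
    -- becomes a sum of nonnegative terms.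
    have h := hu (u.1, -u.2)
    rw [hg p hp, metricForm_apply] at h
    have hval : ∀ x, C.ev x (-C.density p u (u.1, -u.2)) =
        C.ev x (C.dphi p) * C.ev x u.2 ^ 2
          + (C.ev x (C.dphi p))⁻¹ * C.ev x (C.D u.1) ^ 2 := by
      intro x
      rw [map_neg, ev_density hp, map_neg]
      ring
    have hzero : -C.density p u (u.1, -u.2) = 0 := by
      refine C.eq_zero_of_mean _ (fun x => ?_) ?_
      · have := hp x
        rw [hval]
        positivity
      · rw [map_neg]
        linarith
    have hboth : ∀ x, C.ev x u.2 = 0 ∧ C.ev x (C.D u.1) = 0 := by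
      intro x
      have h1 := hval x
      have hx := hp x
      rw [hzero, map_zero, eq_comm,
        add_eq_zero_iff_of_nonneg (by positivity) (by positivity)] at h1
      simpa [hx.ne'] using h1
    refine Prod.ext (C.D_injective (C.ext_ev _ _ fun x => ?_)) (C.ext_ev _ _ fun x => ?_)
    · rw [(hboth x).2, Prod.fst_zero, map_zero, map_zero]
    · rw [(hboth x).1, Prod.snd_zero, map_zero]

theorem isLeviCivita_christoffel
    (hg : ∀ p ∈ C.domain, ∀ u v, g p u v = C.metricForm p u v) :
    IsLeviCivita C.domain g C.christoffel where
  smooth := contDiffOn_christoffel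
  torsionFree _ hp u v := christoffel_comm hp u v
  compatible p hp u v w := by
    have h := ((-(1 / 4 : ℝ) • C.mean).hasFDerivAt.comp p
      (hasFDerivAt_density hp v w)).congr_of_eventuallyEq (f₁ := fun q => g q v w) <| by
        filter_upwards [isOpen_domain.mem_nhds hp] with q hq
        exact hg q hq v w
    refine ⟨h.differentiableAt, ?_⟩
    rw [h.fderiv, hg p hp, hg p hp, metricForm_apply, metricForm_apply, ← mul_add,
      ← mean_densityDeriv hp]
    rfl

end CircleCalculus

/-! ### Uniqueness of the Levi-Civita connection -/

/-- The Koszul formula for constant fields, whose brackets vanish, determines g(Γ(u, v), w) for all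
w; weak nondegeneracy then determines Γ(u, v). -/
theorem IsLeviCivita.eqOn {E : Type*} [NormedAddCommGroup E] [NormedSpace ℝ E] {M : Set E}
    {g : E → E → E → ℝ} {Γ Γ' : E → E →L[ℝ] E →L[ℝ] E} (hg : IsWeakPseudoRiemannian M g)
    (h : IsLeviCivita M g Γ) (h' : IsLeviCivita M g Γ') : Set.EqOn Γ Γ' M := by
  intro p hp
  obtain ⟨B, -, hB⟩ := hg.smooth
  ext u v
  have hkoszul : ∀ Δ : E → E →L[ℝ] E →L[ℝ] E, IsLeviCivita M g Δ → ∀ w,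
      2 * g p (Δ p u v) w = fderiv ℝ (fun q => g q v w) p u + fderiv ℝ (fun q => g q u w) p v
        - fderiv ℝ (fun q => g q u v) p w := by
    intro Δ hΔ w
    rw [(hΔ.compatible p hp u v w).2, (hΔ.compatible p hp v u w).2, (hΔ.compatible p hp w u v).2,
      hΔ.torsionFree p hp v u, hΔ.torsionFree p hp w u, hΔ.torsionFree p hp w v,
      hg.symm p hp (Δ p u w) v]
    ring
  refine sub_eq_zero.1 (hg.nondegenerate p hp _ fun w => ?_)
  have h1 := hkoszul Γ h w
  have h2 := hkoszul Γ' h' w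
  -- Additivity of g is available only through the bilinear form B that represents it.
  rw [← hB p hp, map_sub, sub_apply, hB p hp, hB p hp]
  linarith

/-- The curvature involves the full derivative of Γ at p, so agreement on a neighbourhood is needed;
openness of M provides it. -/
theorem curvature_congr {E : Type*} [NormedAddCommGroup E] [NormedSpace ℝ E] {M : Set E}
    (hM : IsOpen M) {Γ Γ' : E → E →L[ℝ] E →L[ℝ] E} (h : Set.EqOn Γ Γ' M) {p : E} (hp : p ∈ M)
    (u v w : E) : curvature Γ p u v w = curvature Γ' p u v w := by
  have h1 : Γ =ᶠ[nhds p] Γ' := h.eventuallyEq_of_mem (hM.mem_nhds hp)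
  rw [curvature, curvature, h1.fderiv_eq, h hp]

theorem CircleCalculus.sectionalCurvature_eq_one {H A : Type*} [NormedAddCommGroup H]
    [NormedSpace ℝ H] [NormedAddCommGroup A] [NormedSpace ℝ A] {C : CircleCalculus H A}
    {g : H × A → H × A → H × A → ℝ} (hg : ∀ p ∈ C.domain, ∀ u v, g p u v = C.metricForm p u v)
    {Γ : H × A → H × A →L[ℝ] H × A →L[ℝ] H × A} (hΓ : IsLeviCivita C.domain g Γ) {p : H × A}
    (hp : p ∈ C.domain) (u v : H × A) (huv : gram g p u v ≠ 0) :
    sectionalCurvature g Γ p u v = 1 := by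
  have heq := hΓ.eqOn (isWeakPseudoRiemannian hg) (isLeviCivita_christoffel hg)
  rw [sectionalCurvature, curvature_congr isOpen_domain heq hp, curvature_christoffel hp,
    div_eq_one_iff_eq huv, gram]
  have hsymm := (isWeakPseudoRiemannian hg).symm p hp v u
  simp only [hg p hp] at hsymm ⊢
  rw [map_sub, map_smul, map_smul, sub_apply, smul_apply, smul_apply, smul_eq_mul, smul_eq_mul,
    hsymm]
  ring

/-! ### The group `G^s` and the metric in the chart -/

theorem Sobolev.eq_zero_of_mean_eq_zero {r : ℝ} (hr : 1 / 2 < r) (f : Sobolev r)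
    (hf : ∀ x, 0 ≤ f.lift x) (hm : Sobolev.mean hr f = 0) : f = 0 := by
  rw [Sobolev.mean_eq_integral] at hm
  have hzero : ∀ x ∈ Set.Icc (0 : ℝ) 1, f.lift x = 0 := by
    intro x hx
    by_contra hne
    exact (intervalIntegral.integral_pos one_pos f.continuous_lift.continuousOn
      (fun y _ => hf y) ⟨x, hx, lt_of_le_of_ne (hf x) (Ne.symm hne)⟩).ne' hm
  have hper : Function.Periodic f.lift 1 := f.lift_add_one
  -- Periodicity transfers the vanishing on [0, 1] to x through its fractional part.
  refine Sobolev.ext_lift fun x => ?_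
  have h1 := hper.sub_zsmul_eq ⌊x⌋ (x := x)
  rw [zsmul_one, Int.self_sub_floor] at h1
  rw [← h1, hzero _ ⟨Int.fract_nonneg x, (Int.fract_lt_one x).le⟩]
  rfl

theorem Sobolev.isOpen_pos {r : ℝ} (hr : 1 / 2 < r) :
    IsOpen {f : Sobolev r | ∀ x, 0 < f.lift x} := by
  have h : {f : Sobolev r | ∀ x, 0 < f.lift x} = Sobolev.toContinuousMapCLM r hr ⁻¹'
      {f | Set.MapsTo f Set.univ (Set.Ioi 0)} := by
    ext f
    constructor
    · intro h x _
      obtain ⟨y, rfl⟩ := QuotientAddGroup.mk_surjective x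
      exact h y
    · intro h x
      exact h (Set.mem_univ (x : UnitAddCircle))
  rw [h]
  exact (ContinuousMap.isOpen_setOfPred_mapsTo isCompact_univ isOpen_Ioi).preimage
    (Sobolev.toContinuousMapCLM r hr).continuous

section Chart

variable {s : ℝ}

/-- The calculus on the model space of `G^s`. -/
def circleCalculus (hs : 1 / 2 < s - 1) : CircleCalculus (Sobolev₀ s) (Sobolev (s - 1)) where
  D := deriv₀ hs
  J := primitive₀ (by linarith)
  mul := Sobolev.mul hs
  one := 1
  mean := Sobolev.mean hs
  ev := Sobolev.evalCLM hs
  recip := Sobolev.reciprocal hs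
  ext_ev _ _ h := Sobolev.ext_lift h
  ev_mul := Sobolev.lift_mul hs
  ev_one x := Sobolev.lift_one (r := s - 1) x
  ev_recip := Sobolev.lift_reciprocal hs
  contDiffAt_recip := Sobolev.contDiffAt_reciprocal hs
  D_injective := deriv₀_injective hs
  D_J := deriv₀_primitive₀ hs _
  mean_D := mean_deriv₀ hs
  eq_zero_of_mean := Sobolev.eq_zero_of_mean_eq_zero hs
  isOpen_pos := Sobolev.isOpen_pos hs

theorem hasDerivAt_phi (hs : 1 / 2 < s - 1) (p : Model s) (x : ℝ) :
    HasDerivAt (phi p) (((circleCalculus hs).dphi p).lift x) x :=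
  (hasDerivAt_id x).add (hasDerivAt_lift₀ hs p.1 x)

theorem domain_circleCalculus (hs : 1 / 2 < s - 1) : (circleCalculus hs).domain = G s :=
  Set.ext fun p => forall_congr' fun x => by rw [(hasDerivAt_phi hs p x).deriv]; rfl

theorem lift_dphi_pos (hs : 1 / 2 < s - 1) {p : Model s} (hp : p ∈ G s) (x : ℝ) :
    0 < ((circleCalculus hs).dphi p).lift x := by
  rw [← domain_circleCalculus hs] at hp
  exact hp x

/-! ### The lift of φ as a diffeomorphism of the line, and the change of variables. -/

theorem phi_zero (p : Model s) : phi p 0 = 0 := by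
  have h : (p.1 : Sobolev s).lift 0 = 0 := p.1.2
  rw [phi, h, add_zero]

theorem phi_one (p : Model s) : phi p 1 = 1 := by
  have h : (p.1 : Sobolev s).lift 0 = 0 := p.1.2
  have h1 := (p.1 : Sobolev s).lift_add_one 0
  rw [zero_add] at h1
  rw [phi, h1, h, add_zero]

theorem continuous_phi (p : Model s) : Continuous (phi p) :=
  continuous_id.add (Sobolev.continuous_lift _)

theorem strictMono_phi {p : Model s} (hp : p ∈ G s) : StrictMono (phi p) :=
  strictMono_of_deriv_pos hp

/-- The identity plus a bounded continuous function. Together with strict monotonicity this makes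
`Function.invFun (phi p)` the genuine inverse for p in `G s`. -/
theorem surjective_phi (p : Model s) : Function.Surjective (phi p) := by
  have hb : ∀ x, |(p.1 : Sobolev s).lift x| ≤ ‖(p.1 : Sobolev s).toContinuousMap‖ := fun x =>
    (p.1 : Sobolev s).toContinuousMap.norm_coe_le_norm x
  refine (continuous_phi p).surjective ?_ ?_
  · refine Filter.tendsto_atTop_mono (fun x => ?_)
      (Filter.tendsto_atTop_add_const_right _ (-‖(p.1 : Sobolev s).toContinuousMap‖)
        Filter.tendsto_id)
    have := (abs_le.1 (hb x)).1
    unfold phi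
    simp only [id]
    linarith
  · refine Filter.tendsto_atBot_mono (fun x => ?_)
      (Filter.tendsto_atBot_add_const_right _ ‖(p.1 : Sobolev s).toContinuousMap‖
        Filter.tendsto_id)
    have := (abs_le.1 (hb x)).2
    unfold phi
    simp only [id]
    linarith

theorem phi_invFun (p : Model s) (y : ℝ) : phi p (Function.invFun (phi p) y) = y :=
  Function.rightInverse_invFun (surjective_phi p) y

theorem invFun_phi {p : Model s} (hp : p ∈ G s) (x : ℝ) : Function.invFun (phi p) (phi p x) = x :=
  Function.leftInverse_invFun (strictMono_phi hp).injective x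

theorem continuous_invFun_phi {p : Model s} (hp : p ∈ G s) :
    Continuous (Function.invFun (phi p)) := by
  let e := (strictMono_phi hp).orderIsoOfSurjective _ (surjective_phi p)
  have h : Function.invFun (phi p) = e.symm := by
    funext y
    refine e.injective ?_
    rw [e.apply_symm_apply]
    exact phi_invFun p y
  rw [h]
  exact e.symm.continuous

theorem hasDerivAt_invFun_phi (hs : 1 / 2 < s - 1) {p : Model s} (hp : p ∈ G s) (y : ℝ) :
    HasDerivAt (Function.invFun (phi p))
      (((circleCalculus hs).dphi p).lift (Function.invFun (phi p) y))⁻¹ y :=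
  (hasDerivAt_phi hs p _).of_local_left_inverse (continuous_invFun_phi hp).continuousAt
    (lift_dphi_pos hs hp _).ne' (Filter.Eventually.of_forall (phi_invFun p))

/-- Each derivative of U₁ ∘ φ⁻¹ carries a factor 1/φₓ by the chain rule, and dy = φₓ dx under y =
φ(x). The limits stay 0 and 1 because φ fixes both. -/
theorem metric_eq_integral (hs : 1 / 2 < s - 1) (κ : ℝ) {p : Model s} (hp : p ∈ G s) (U V : Model s) :
    metric κ p U V = (1 / 4) * ∫ x in (0 : ℝ)..1,
      ((deriv₀ hs U.1).lift x * (deriv₀ hs V.1).lift x * (((circleCalculus hs).dphi p).lift x)⁻¹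
        + κ * (U.2.lift x * V.2.lift x) * ((circleCalculus hs).dphi p).lift x) := by
  have hm := lift_dphi_pos hs hp
  let ψ := Function.invFun (phi p)
  have hd : ∀ (W : Model s) (y : ℝ), deriv ((W.1 : Sobolev s).lift ∘ ψ) y
      = (deriv₀ hs W.1).lift (ψ y) * (((circleCalculus hs).dphi p).lift (ψ y))⁻¹ := fun W y =>
    ((hasDerivAt_lift₀ hs W.1 (ψ y)).comp y (hasDerivAt_invFun_phi hs hp y)).deriv
  let F : ℝ → ℝ := fun x =>
    (deriv₀ hs U.1).lift x * (((circleCalculus hs).dphi p).lift x)⁻¹ *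
      ((deriv₀ hs V.1).lift x * (((circleCalculus hs).dphi p).lift x)⁻¹) + κ * (U.2.lift x * V.2.lift x)
  have hF : Continuous F := by
    have h1 : Continuous fun x => (((circleCalculus hs).dphi p).lift x)⁻¹ :=
      (Sobolev.continuous_lift _).inv₀ fun x => (hm x).ne'
    exact ((((Sobolev.continuous_lift _).mul h1).mul ((Sobolev.continuous_lift _).mul h1))).add
      (continuous_const.mul ((Sobolev.continuous_lift _).mul (Sobolev.continuous_lift _)))
  have h := intervalIntegral.integral_comp_mul_deriv (a := 0) (b := 1)
    (fun x _ => hasDerivAt_phi hs p x) (Sobolev.continuous_lift ((circleCalculus hs).dphi p)).continuousOn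
    (hF.comp (continuous_invFun_phi hp))
  rw [phi_zero, phi_one] at h
  have h2 : metric κ p U V = (1 / 4) * ∫ y in (0 : ℝ)..1, (F ∘ ψ) y := by
    unfold metric metricId
    congr 1
    refine intervalIntegral.integral_congr fun y _ => ?_
    change deriv ((U.1 : Sobolev s).lift ∘ ψ) y * deriv ((V.1 : Sobolev s).lift ∘ ψ) y + _ = _
    rw [hd, hd]
    rfl
  rw [h2, ← h]
  congr 1
  refine intervalIntegral.integral_congr fun x _ => ?_
  have hx := (hm x).ne'
  simp only [Function.comp_apply, F, invFun_phi hp]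
  field_simp

theorem metric_eq_metricForm (hs : 1 / 2 < s - 1) {p : Model s} (hp : p ∈ G s) (u v : Model s) :
    metric (-1) p u v = (circleCalculus hs).metricForm p u v := by
  have hp' : p ∈ (circleCalculus hs).domain := by rwa [domain_circleCalculus]
  have h : (circleCalculus hs).mean ((circleCalculus hs).density p u v)
      = ∫ x in (0 : ℝ)..1, ((circleCalculus hs).density p u v).lift x :=
    Sobolev.mean_eq_integral hs _
  rw [metric_eq_integral hs (-1) hp, CircleCalculus.metricForm_apply, h, neg_mul, ← mul_neg,
    ← intervalIntegral.integral_neg]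
  congr 1
  refine intervalIntegral.integral_congr fun x _ => ?_
  have h2 : ((circleCalculus hs).density p u v).lift x =
      ((circleCalculus hs).dphi p).lift x * (u.2.lift x * v.2.lift x)
        - (((circleCalculus hs).dphi p).lift x)⁻¹ *
          ((deriv₀ hs u.1).lift x * (deriv₀ hs v.1).lift x) :=
    CircleCalculus.ev_density hp' u v x
  simp only [h2]
  ring

end Chart

end

end HunterSaxton

theorem corollary3p3 (s : ℝ) (hs : 5 / 2 < s) :
    IsOpen (HunterSaxton.G s) ∧
    HunterSaxton.IsWeakPseudoRiemannian (HunterSaxton.G s) (HunterSaxton.metric (-1)) ∧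
    (∃ Γ : HunterSaxton.Model s →
        HunterSaxton.Model s →L[ℝ] HunterSaxton.Model s →L[ℝ] HunterSaxton.Model s,
      HunterSaxton.IsLeviCivita (HunterSaxton.G s) (HunterSaxton.metric (-1)) Γ) ∧
    (∀ Γ : HunterSaxton.Model s →
        HunterSaxton.Model s →L[ℝ] HunterSaxton.Model s →L[ℝ] HunterSaxton.Model s,
      HunterSaxton.IsLeviCivita (HunterSaxton.G s) (HunterSaxton.metric (-1)) Γ →
      ∀ p ∈ HunterSaxton.G s, ∀ u v : HunterSaxton.Model s,
        HunterSaxton.gram (HunterSaxton.metric (-1)) p u v ≠ 0 →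
        HunterSaxton.sectionalCurvature (HunterSaxton.metric (-1)) Γ p u v = 1) := by
  have hs1 : 1 / 2 < s - 1 := by linarith
  have hg : ∀ p ∈ (HunterSaxton.circleCalculus hs1).domain, ∀ u v,
      HunterSaxton.metric (-1) p u v = (HunterSaxton.circleCalculus hs1).metricForm p u v := by
    rw [HunterSaxton.domain_circleCalculus]
    exact fun p hp => HunterSaxton.metric_eq_metricForm hs1 hp
  rw [← HunterSaxton.domain_circleCalculus hs1]
  exact ⟨HunterSaxton.CircleCalculus.isOpen_domain,
    HunterSaxton.CircleCalculus.isWeakPseudoRiemannian hg,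
    ⟨_, HunterSaxton.CircleCalculus.isLeviCivita_christoffel hg⟩,
    fun _ hΓ _ hp u v huv =>
      HunterSaxton.CircleCalculus.sectionalCurvature_eq_one hg hΓ hp u v huv⟩
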